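/- Let $\phi\in C_c^\infty((1,\infty))$ be nonnegative and such that $\mu=\phi(\sqrt{x^2+y^2})\,dx\,dy$ is a probability measure on $\mathbb{C}$. For every $n$ let $z_1,\dots,z_n$ be independent random variables with law $\mu$ (no relation between different $n$ is assumed), let $p_n(z)=\prod_{k=1}^n (z-z_k)$ and $f_n=p_n-p_n(0)$. Define $$B_n(z)=\prod_{|\alpha|\le 1,\ f_n(\alpha)=0}\frac{z-\alpha}{1-\overline{\alpha}z}$$ (roots counted with multiplicity), and let $G_n=f_n/B_n$, that is, the polynomial obtained from the factorization of $f_n$ into linear factors by replacing every factor $z-\alpha$ with $|\alpha|\le 1$ by $1-\overline{\alpha}z$. Then: 1. For all $n\ge 1$ the Blaschke factorization $p_n(z)=p_n(0)+B_n(z)\,G_n(z)$ holds for all $z\in\mathbb{C}$ other than the points $1/\overline{\alpha}$ with $f_n(\alpha)=0$, $0<|\alpha|<1$ (in particular for all $|z|\le 1$), and $G_n$ has no zeros in the open unit disk. 2. The roots of $G_n$ are asymptotically distributed according to $\mu$: if $w_1,\dots,w_m$ are the roots of $G_n$ with multiplicity, then $\frac1m\sum_{j=1}^m\delta_{w_j}\to\mu$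 weakly in probability as $n\to\infty$, i.e. for every bounded continuous $g:\mathbb{C}\to\mathbb{R}$ and every $\varepsilon>0$, $$\mathbb{P}\Big(\Big|\frac1m\sum_{j=1}^m g(w_j)-\int_{\mathbb{C}} g\,d\mu\Big|\ge\varepsilon\Big)\to 0\qquad (n\to\infty),$$ where the empirical measure is read as $0$ if $G_n$ has no roots. 3. With high probability $p_n-p_n(0)$ has only $o(n)$ roots in the closed unit disk: for every $\varepsilon>0$, the probability that $p_n-p_n(0)$ has at least $\varepsilon n$ roots (with multiplicity) of modulus at most $1$ tends to $0$ as $n\to\infty$. -/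

import Mathlib

open MeasureTheory ProbabilityTheory Filter
open scoped Polynomial Topology BoundedContinuousFunction ENNReal ComplexConjugate

namespace RandomBlaschke

/-- The radial measure `φ(√(x² + y²)) dx dy` on the complex plane. -/
noncomputable def radialMeasure (φ : ℝ → ℝ) : Measure ℂ :=
  (volume : Measure ℂ).withDensity fun z => ENNReal.ofReal (φ ‖z‖)

/-- The monic polynomial `∏ₖ (X - zₖ)` with prescribed roots `z₁, …, zₙ`. -/
noncomputable def polyOfRoots {n : ℕ} (z : Fin n → ℂ) : ℂ[X] :=
  ∏ k, (Polynomial.X - Polynomial.C (z k))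

/-- The polynomial `p - p(0)`. -/
noncomputable def subValueAtZero (p : ℂ[X]) : ℂ[X] :=
  p - Polynomial.C (p.eval 0)

/-- The roots of `f` (with multiplicity) in the closed unit disk. -/
noncomputable def rootsInDisk (f : ℂ[X]) : Multiset ℂ :=
  open Classical in f.roots.filter fun α => ‖α‖ ≤ 1

/-- The roots of `f` (with multiplicity) outside the closed unit disk. -/
noncomputable def rootsOutsideDisk (f : ℂ[X]) : Multiset ℂ :=
  open Classical in f.roots.filter fun α => ¬ ‖α‖ ≤ 1

/-- The finite Blaschke product `B(z) = ∏ (z - α) / (1 - conj α * z)` over all roots `α` of `f`,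
with multiplicity, in the closed unit disk. A root with `‖α‖ = 1` contributes a unimodular constant
(away from the point `α` itself). -/
noncomputable def blaschkeProduct (f : ℂ[X]) (z : ℂ) : ℂ :=
  ((rootsInDisk f).map fun α => (z - α) / (1 - conj α * z)).prod

/-- The outer factor `G = f / B` of a polynomial `f` in its Blaschke factorization `f = B * G`,
cleared of fractions: in the factorization of `f` into linear factors, every factor `X - α` with
`‖α‖ ≤ 1` is replaced by `1 - conj α * X`. Thus `G` has the roots of `f` outside the disk and the
roots `1 / conj α` for the roots `α ≠ 0` of `f` inside the disk. -/
noncomputable def outerFactor (f : ℂ[X]) : ℂ[X] :=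
  Polynomial.C f.leadingCoeff *
    ((rootsInDisk f).map fun α => 1 - Polynomial.C (conj α) * Polynomial.X).prod *
    ((rootsOutsideDisk f).map fun α => Polynomial.X - Polynomial.C α).prod

/-- The normalized counting measure of a finite multiset of points, with multiplicity
(the zero measure for the empty multiset). -/
noncomputable def empiricalMeasure (s : Multiset ℂ) : Measure ℂ :=
  (s.card : ℝ≥0∞)⁻¹ • (s.map fun w => Measure.dirac w).sum

/-- Weak convergence in probability of random measures `ν n` on `ℂ` (where `ν n` lives on its own
probability space) to a deterministic measure `μ`: for every bounded continuous test function `g`,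
`∫ g dν n` converges to `∫ g dμ` in probability. -/
def TendstoWeaklyInProbability {Ω : ℕ → Type*} [∀ n, MeasurableSpace (Ω n)]
    (P : ∀ n, Measure (Ω n)) (ν : ∀ n, Ω n → Measure ℂ) (μ : Measure ℂ) : Prop :=
  ∀ g : ℂ →ᵇ ℝ, ∀ ε : ℝ, 0 < ε →
    Tendsto (fun n => P n {ω | ε ≤ |(∫ w, g w ∂(ν n ω)) - ∫ w, g w ∂μ|}) atTop (𝓝 0)

end RandomBlaschke

/-! Root distributions are compared through logarithmic potentials. Since `(p(z) - p(0)) / p(z) = 1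
- ∏ (1 - z / zₖ)⁻¹`, the potentials of the roots of `p - p(0)` and of the `zₖ` differ by the `log`
of the modulus of the right-hand side, and it suffices that this is `o(n)`.

For fixed `z ≠ 0` this holds in probability (`tendsto_measure_logRatio`). Rotation invariance and
Jensen's formula give `E log |1 - z / zₖ| ≥ 0`, so by the law of large numbers the product is at
least `exp (-εn)`, which bounds the ratio above. The ratio is rarely tiny because one factor, given
the others, has bounded density and seldom comes within `exp (-εn)` of a prescribed value
(`measure_pi_norm_sub_le`).

A deterministic `L²` bound of order `n` upgrades this to an `o(n)` bound in `L¹` on disks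
(`tendsto_measure_le_lintegral_logRatio`). Averaging potentials over circles turns that into
closeness of sums of test functions (`exists_enorm_sum_sub_le`), and the law of large numbers for
the `zₖ` identifies the limit as `μ` (`tendsto_measure_sum_roots`).

As `μ` lives on an annulus outside the closed unit disk, only `o(n)` roots lie in that disk. Passing
to the outer factor moves or deletes only those, so its roots have the same limit. -/

namespace RandomBlaschke

/-! ### Potentials control sums of test functions -/

/-- The difference of the logarithmic potentials of the uniform measures on the circles of radius
`2 * δ` and `δ`: a nonnegative bump supported in the disk of radius `2 * δ`. -/
noncomputable def logBump (δ : ℝ) (w : ℂ) : ℝ :=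
  Real.log (2 * δ) + Real.posLog ((2 * δ)⁻¹ * ‖w‖) - (Real.log δ + Real.posLog (δ⁻¹ * ‖w‖))

/-- The difference of the logarithmic potentials of two finite families of points. -/
noncomputable def potentialDiff {n : ℕ} (a b : Fin n → ℂ) (z : ℂ) : ℝ :=
  ∑ i, (Real.log ‖z - a i‖ - Real.log ‖z - b i‖)

lemma continuous_logBump (δ : ℝ) : Continuous (logBump δ) := by
  unfold logBump
  have := Real.continuous_posLog
  fun_prop

lemma logBump_eq_zero {δ : ℝ} (hδ : 0 < δ) {w : ℂ} (hw : 2 * δ ≤ ‖w‖) : logBump δ w = 0 := by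
  have hw0 : 0 < ‖w‖ := by linarith
  have h1 : 1 ≤ (2 * δ)⁻¹ * ‖w‖ := by
    rw [inv_mul_eq_div, one_le_div (by positivity)]; exact hw
  have h2 : 1 ≤ δ⁻¹ * ‖w‖ := by
    rw [inv_mul_eq_div, one_le_div (by positivity)]; linarith
  rw [logBump, Real.posLog_eq_log (by rwa [abs_of_nonneg (by positivity)]),
    Real.posLog_eq_log (by rwa [abs_of_nonneg (by positivity)]),
    Real.log_mul (inv_pos.2 (by positivity)).ne' hw0.ne', Real.log_mul (inv_pos.2 hδ).ne' hw0.ne',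
    Real.log_inv, Real.log_inv]
  ring

/-- This is the inequality `log⁺ (2y) ≤ log 2 + log⁺ y`. -/
lemma logBump_nonneg {δ : ℝ} (hδ : 0 < δ) (w : ℂ) : 0 ≤ logBump δ w := by
  have h2 : δ⁻¹ * ‖w‖ = 2 * ((2 * δ)⁻¹ * ‖w‖) := by field_simp
  have h := Real.posLog_mul (x := 2) (y := (2 * δ)⁻¹ * ‖w‖)
  have h3 : Real.posLog 2 = Real.log 2 := Real.posLog_eq_log (by norm_num)
  rw [logBump, h2, Real.log_mul (by norm_num) hδ.ne']
  linarith

lemma logBump_zero {δ : ℝ} (hδ : 0 < δ) : logBump δ 0 = Real.log 2 := by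
  simp [logBump, Real.log_mul (two_ne_zero) hδ.ne']

lemma hasCompactSupport_logBump {δ : ℝ} (hδ : 0 < δ) : HasCompactSupport (logBump δ) := by
  refine HasCompactSupport.intro (isCompact_closedBall (0 : ℂ) (2 * δ)) fun w hw => ?_
  exact logBump_eq_zero hδ (by simpa using le_of_lt (by simpa using hw))

lemma integrable_logBump {δ : ℝ} (hδ : 0 < δ) : Integrable (logBump δ) :=
  (continuous_logBump δ).integrable_of_hasCompactSupport (hasCompactSupport_logBump hδ)

lemma integral_logBump_pos {δ : ℝ} (hδ : 0 < δ) : 0 < ∫ w, logBump δ w :=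
  (continuous_logBump δ).integral_pos_of_hasCompactSupport_nonneg_nonzero
    (hasCompactSupport_logBump hδ) (logBump_nonneg hδ) (x := 0)
    (by rw [logBump_zero hδ]; exact (Real.log_pos one_lt_two).ne')

lemma circleAverage_potentialDiff {n : ℕ} (a b : Fin n → ℂ) (c : ℂ) {r : ℝ} (hr : r ≠ 0) :
    Real.circleAverage (potentialDiff a b) c r =
      ∑ i, ((Real.log r + Real.posLog (r⁻¹ * ‖c - a i‖)) -
        (Real.log r + Real.posLog (r⁻¹ * ‖c - b i‖))) := by
  have h : potentialDiff a b = ∑ i, fun z => (Real.log ‖z - a i‖ - Real.log ‖z - b i‖) := by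
    ext z; simp [potentialDiff]
  rw [h, Real.circleAverage_sum]
  swap
  · exact fun i _ => (circleIntegrable_log_norm_sub_const r).sub
      (circleIntegrable_log_norm_sub_const r)
  refine Finset.sum_congr rfl fun i _ => ?_
  rw [← circleAverage_log_norm_sub_const_eq_log_radius_add_posLog hr,
    ← circleAverage_log_norm_sub_const_eq_log_radius_add_posLog hr,
    ← Real.circleAverage_sub (circleIntegrable_log_norm_sub_const r)
    (circleIntegrable_log_norm_sub_const r)]
  rfl

/-- The mean of `log |· - a|` over the circle of radius `r` about `c` is `log r + log⁺ (|c - a| /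
r)`. Taking radii `2δ` and `δ` thus converts potentials into compactly supported bumps. -/
lemma sum_logBump_sub {n : ℕ} (a b : Fin n → ℂ) (c : ℂ) {δ : ℝ} (hδ : 0 < δ) :
    ∑ i, (logBump δ (c - a i) - logBump δ (c - b i)) =
      Real.circleAverage (potentialDiff a b) c (2 * δ) -
        Real.circleAverage (potentialDiff a b) c δ := by
  rw [circleAverage_potentialDiff a b c (by positivity : 2 * δ ≠ 0),
    circleAverage_potentialDiff a b c hδ.ne', ← Finset.sum_sub_distrib]
  refine Finset.sum_congr rfl fun i _ => ?_
  simp only [logBump]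
  ring

@[fun_prop]
lemma measurable_potentialDiff {n : ℕ} (a b : Fin n → ℂ) : Measurable (potentialDiff a b) := by
  unfold potentialDiff
  fun_prop

/-- By Tonelli, the centre can be integrated first for each fixed angle; this is a translation by a
vector of length `r`, which enlarges the ball by at most `r`. -/
lemma lintegral_circleAverage_le {S : ℂ → ℝ} (hS : Measurable S) (M : ℝ) {r : ℝ} (hr : 0 ≤ r) :
    ∫⁻ c in Metric.ball 0 M, ‖Real.circleAverage S c r‖ₑ ≤
      ∫⁻ z in Metric.ball 0 (M + r), ‖S z‖ₑ := by
  have hm : Measurable fun p : ℂ × ℝ => ‖S (circleMap p.1 r p.2)‖ₑ := by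
    unfold circleMap; fun_prop
  have h0 : (0 : ℝ) ≤ 2 * Real.pi := by positivity
  calc ∫⁻ c in Metric.ball 0 M, ‖Real.circleAverage S c r‖ₑ
      ≤ ∫⁻ c in Metric.ball 0 M, ENNReal.ofReal (2 * Real.pi)⁻¹ *
          ∫⁻ θ in Set.Ioc 0 (2 * Real.pi), ‖S (circleMap c r θ)‖ₑ := by
        refine lintegral_mono fun c => ?_
        rw [Real.circleAverage_def, enorm_smul, intervalIntegral.integral_of_le h0,
          Real.enorm_of_nonneg (by positivity)]
        gcongr
        exact enorm_integral_le_lintegral_enorm _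
    _ = ENNReal.ofReal (2 * Real.pi)⁻¹ * ∫⁻ θ in Set.Ioc 0 (2 * Real.pi),
          ∫⁻ c in Metric.ball 0 M, ‖S (circleMap c r θ)‖ₑ := by
        rw [lintegral_const_mul _ hm.lintegral_prod_right', lintegral_lintegral_swap hm.aemeasurable]
    _ ≤ ENNReal.ofReal (2 * Real.pi)⁻¹ * ∫⁻ θ in Set.Ioc 0 (2 * Real.pi),
          ∫⁻ z in Metric.ball 0 (M + r), ‖S z‖ₑ := by
        refine mul_le_mul_right (lintegral_mono fun θ => ?_) _
        rw [← lintegral_indicator measurableSet_ball, ← lintegral_indicator measurableSet_ball]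
        refine le_trans (lintegral_mono fun c => ?_)
          (lintegral_add_right_eq_self _ (circleMap 0 r θ)).le
        by_cases hc : c ∈ Metric.ball (0 : ℂ) M
        · rw [Set.indicator_of_mem hc, Set.indicator_of_mem]
          · simp [circleMap, add_comm]
          · rw [mem_ball_zero_iff] at hc ⊢
            refine (norm_add_le _ _).trans_lt ?_
            rw [norm_circleMap_zero, abs_of_nonneg hr]
            linarith
        · rw [Set.indicator_of_notMem hc]
          positivity
    _ = ∫⁻ z in Metric.ball 0 (M + r), ‖S z‖ₑ := by
        rw [setLIntegral_const, Real.volume_Ioc, sub_zero, mul_comm, mul_assoc,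
          ← ENNReal.ofReal_mul h0, mul_inv_cancel₀ (by positivity), ENNReal.ofReal_one, mul_one]

/-- Smoothing a test function `g` by `logBump δ` changes it by little. -/
lemma abs_integral_mul_logBump_sub_le {g : ℂ → ℝ} (hg : Continuous g) {δ η A : ℝ} (hδ : 0 < δ)
    (hδ1 : 2 * δ ≤ 1)
    (h : ∀ x ∈ Metric.closedBall (0 : ℂ) (A + 1), ∀ y ∈ Metric.closedBall (0 : ℂ) (A + 1),
      dist x y < 2 * δ → |g x - g y| ≤ η) {a : ℂ} (ha : ‖a‖ ≤ A) :
    |(∫ w, logBump δ w) * g a - ∫ c, g c * logBump δ (c - a)| ≤ η * ∫ w, logBump δ w := by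
  have hs : ∀ a : ℂ, Integrable fun c => logBump δ (c - a) := fun a =>
    (integrable_logBump hδ).comp_sub_right a
  have hgi : Integrable fun c => g c * logBump δ (c - a) := by
    refine (hg.mul ((continuous_logBump δ).comp (by fun_prop))).integrable_of_hasCompactSupport ?_
    exact ((hasCompactSupport_logBump hδ).comp_homeomorph (Homeomorph.subRight a)).mul_left
  have hκ : ∫ w, logBump δ w = ∫ c, logBump δ (c - a) := (integral_sub_right_eq_self _ a).symm
  rw [hκ, ← integral_mul_const, ← integral_sub ((hs a).mul_const _) hgi, ← integral_const_mul]
  refine abs_integral_le_integral_abs.trans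
    (integral_mono_of_nonneg (ae_of_all _ fun _ => abs_nonneg _) ((hs a).const_mul _)
    (ae_of_all _ fun c => ?_))
  have h0 := logBump_nonneg hδ (c - a)
  simp only
  rw [mul_comm, ← sub_mul, abs_mul, abs_of_nonneg h0]
  rcases le_or_gt (2 * δ) ‖c - a‖ with hc | hc
  · simp [logBump_eq_zero hδ hc]
  · refine mul_le_mul_of_nonneg_right (h a ?_ c ?_ ?_) h0
    · rw [mem_closedBall_zero_iff]; linarith
    · rw [mem_closedBall_zero_iff]
      calc ‖c‖ = ‖(c - a) + a‖ := by simp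
        _ ≤ ‖c - a‖ + ‖a‖ := norm_add_le _ _
        _ ≤ A + 1 := by linarith
    · rwa [dist_comm, dist_eq_norm]

/-- Sums of a continuous function over two families of points are close to each other if the
logarithmic potentials of the families are close in `L¹`. -/
lemma exists_enorm_sum_sub_le (g : ℂ →ᵇ ℝ) (A : ℝ) {η : ℝ} (hη : 0 < η) :
    ∃ (C : ℝ≥0∞) (M : ℝ), C ≠ ∞ ∧ ∀ (n : ℕ) (a b : Fin n → ℂ), (∀ i, ‖a i‖ ≤ A) →
      (∀ i, ‖b i‖ ≤ A) → ‖∑ i, (g (a i) - g (b i))‖ₑ ≤ ENNReal.ofReal (η * n) +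
        C * ∫⁻ z in Metric.ball 0 M, ‖potentialDiff a b z‖ₑ := by
  obtain ⟨d, hd, hgd⟩ := Metric.uniformContinuousOn_iff.1
    ((isCompact_closedBall (0 : ℂ) (A + 1)).uniformContinuousOn_of_continuous
      g.continuous.continuousOn) (η / 2) (by positivity)
  set δ := min (d / 2) (1 / 2) with hδ_def
  have hδ : 0 < δ := by positivity
  have hδ1 : 2 * δ ≤ 1 := by linarith [min_le_right (d / 2) (1 / 2 : ℝ)]
  have hδd : 2 * δ ≤ d := by linarith [min_le_left (d / 2) (1 / 2 : ℝ)]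
  set κ := ∫ w, logBump δ w with hκ_def
  have hκ : 0 < κ := integral_logBump_pos hδ
  have happ : ∀ a : ℂ, ‖a‖ ≤ A → |κ * g a - ∫ c, g c * logBump δ (c - a)| ≤ η / 2 * κ :=
    fun a ha => abs_integral_mul_logBump_sub_le g.continuous hδ hδ1 (fun x hx y hy hxy =>
      (hgd x hx y hy (hxy.trans_le hδd)).le) ha
  -- The factor `2` counts the two circle radii. One `+ 1` makes room for the bumps around the
  -- points, the other for the circles around their centres; both use `2 * δ ≤ 1`.
  refine ⟨ENNReal.ofReal κ⁻¹ * (‖‖g‖‖ₑ * 2), A + 1 + 1,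
    by simp [ENNReal.mul_eq_top], fun n a b ha hb => ?_⟩
  have hgi : ∀ a : ℂ, Integrable fun c => g c * logBump δ (c - a) := fun a => by
    refine (g.continuous.mul
      ((continuous_logBump δ).comp (by fun_prop))).integrable_of_hasCompactSupport ?_
    exact ((hasCompactSupport_logBump hδ).comp_homeomorph (Homeomorph.subRight a)).mul_left
  have hsplit : κ * ∑ i, (g (a i) - g (b i)) =
      ∑ i, ((κ * g (a i) - ∫ c, g c * logBump δ (c - a i)) -
        (κ * g (b i) - ∫ c, g c * logBump δ (c - b i))) +
      ∫ c, g c * ∑ i, (logBump δ (c - a i) - logBump δ (c - b i)) := by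
    have : ∫ c, g c * ∑ i, (logBump δ (c - a i) - logBump δ (c - b i)) =
        ∑ i, ((∫ c, g c * logBump δ (c - a i)) - ∫ c, g c * logBump δ (c - b i)) := by
      simp_rw [Finset.mul_sum, mul_sub]
      rw [integral_finsetSum]
      swap
      · exact fun i _ => (hgi _).sub (hgi _)
      exact Finset.sum_congr rfl fun i _ => integral_sub (hgi _) (hgi _)
    rw [this, ← Finset.sum_add_distrib, Finset.mul_sum]
    exact Finset.sum_congr rfl fun i _ => by ring
  have h1 : ‖∑ i, ((κ * g (a i) - ∫ c, g c * logBump δ (c - a i)) -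
        (κ * g (b i) - ∫ c, g c * logBump δ (c - b i)))‖ ≤ η * κ * n := by
    refine (norm_sum_le _ _).trans ?_
    refine (Finset.sum_le_card_nsmul _ _ (η * κ) fun i _ => ?_).trans
      (by simp [mul_comm])
    refine (norm_sub_le _ _).trans ?_
    have := happ _ (ha i)
    have := happ _ (hb i)
    simp only [Real.norm_eq_abs]
    linarith
  have h2 : ‖∫ c, g c * ∑ i, (logBump δ (c - a i) - logBump δ (c - b i))‖ₑ ≤
      ‖‖g‖‖ₑ * 2 * ∫⁻ z in Metric.ball 0 (A + 1 + 1), ‖potentialDiff a b z‖ₑ := by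
    have hsupp : ∀ a : ℂ, ‖a‖ ≤ A → ∀ c ∉ Metric.ball (0 : ℂ) (A + 1),
        logBump δ (c - a) = 0 := fun a ha c hc => by
      refine logBump_eq_zero hδ ?_
      have := norm_sub_norm_le c a
      rw [mem_ball_zero_iff, not_lt] at hc
      linarith
    rw [← setIntegral_eq_integral_of_forall_compl_eq_zero (s := Metric.ball (0 : ℂ) (A + 1))
      fun c hc => by simp [hsupp _ (ha _) c hc, hsupp _ (hb _) c hc]]
    refine (enorm_integral_le_lintegral_enorm _).trans ?_
    have hm := measurable_potentialDiff a b
    calc ∫⁻ c in Metric.ball 0 (A + 1),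
          ‖g c * ∑ i, (logBump δ (c - a i) - logBump δ (c - b i))‖ₑ
        ≤ ∫⁻ c in Metric.ball 0 (A + 1), ‖‖g‖‖ₑ *
            (‖Real.circleAverage (potentialDiff a b) c (2 * δ)‖ₑ +
              ‖Real.circleAverage (potentialDiff a b) c δ‖ₑ) := by
          refine lintegral_mono fun c => ?_
          rw [sum_logBump_sub a b c hδ, enorm_mul]
          refine mul_le_mul' ?_ (enorm_sub_le)
          rw [enorm_le_iff_norm_le, norm_norm]
          exact g.norm_coe_le_norm c
      _ = ‖‖g‖‖ₑ * ((∫⁻ c in Metric.ball 0 (A + 1),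
            ‖Real.circleAverage (potentialDiff a b) c (2 * δ)‖ₑ) +
              ∫⁻ c in Metric.ball 0 (A + 1), ‖Real.circleAverage (potentialDiff a b) c δ‖ₑ) := by
          rw [lintegral_const_mul' _ _ (by simp), lintegral_add_left]
          simp_rw [circleAverage_potentialDiff a b _ (by positivity : 2 * δ ≠ 0)]
          have := Real.continuous_posLog
          fun_prop
      _ ≤ ‖‖g‖‖ₑ * ((∫⁻ z in Metric.ball 0 (A + 1 + 1), ‖potentialDiff a b z‖ₑ) +
            ∫⁻ z in Metric.ball 0 (A + 1 + 1), ‖potentialDiff a b z‖ₑ) := by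
          refine mul_le_mul_right (add_le_add ?_ ?_) _
          · refine (lintegral_circleAverage_le hm _ (by positivity)).trans
              (lintegral_mono_set (Metric.ball_subset_ball ?_))
            linarith
          · refine (lintegral_circleAverage_le hm _ hδ.le).trans
              (lintegral_mono_set (Metric.ball_subset_ball ?_))
            linarith
      _ = _ := by rw [mul_assoc, two_mul]
  have h3 : ∑ i, (g (a i) - g (b i)) = κ⁻¹ * (κ * ∑ i, (g (a i) - g (b i))) := by
    field_simp
  rw [h3, hsplit, mul_add]
  refine (enorm_add_le _ _).trans (add_le_add ?_ ?_)
  · rw [← ofReal_norm, norm_mul, Real.norm_of_nonneg (by positivity)]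
    refine ENNReal.ofReal_le_ofReal ?_
    calc _ ≤ κ⁻¹ * (η * κ * n) := by gcongr
      _ = η * n := by field_simp
  · rw [enorm_mul, Real.enorm_of_nonneg (by positivity), mul_assoc]
    gcongr

/-! ### Square integrability of logarithmic potentials on disks -/

lemma memLp_log_norm (M : ℝ) :
    MemLp (fun w : ℂ => Real.log ‖w‖) 2 (volume.restrict (Metric.ball 0 M)) := by
  rw [memLp_two_iff_integrable_sq (Measurable.aestronglyMeasurable (by fun_prop))]
  have h := (integrableOn_fun_norm_addHaar (E := ℂ) volume (f := fun x => Real.log x ^ 2)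
    (r := M)).2 ?_
  · exact h
  -- In polar coordinates the integrand is `y log² y`; in this form its continuity at `0` follows
  -- from that of `x log x`.
  have hc : Continuous fun y : ℝ => 4 * (√y * Real.log √y) ^ 2 := by
    have := Real.continuous_mul_log.comp Real.continuous_sqrt
    simp only [Function.comp_def] at this
    fun_prop
  refine ((hc.integrableOn_Icc (a := 0) (b := M)).mono_set Set.Ioo_subset_Icc_self).congr_fun ?_
    measurableSet_Ioo
  intro y hy
  have hy0 : 0 ≤ y := hy.1.le
  simp only [Complex.finrank_real_complex, Nat.add_one_sub_one, pow_one, smul_eq_mul]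
  rw [Real.log_sqrt hy0, mul_pow, Real.sq_sqrt hy0]
  ring

/-- The integral of `log² ‖w‖` over a disk about the origin. -/
noncomputable def logSqIntegral (M : ℝ) : ℝ≥0∞ :=
  ∫⁻ w in Metric.ball (0 : ℂ) M, ‖Real.log ‖w‖‖ₑ ^ 2

lemma logSqIntegral_lt_top (M : ℝ) : logSqIntegral M < ∞ := by
  have := (memLp_log_norm M).eLpNorm_lt_top
  rw [eLpNorm_lt_top_iff_lintegral_rpow_enorm_lt_top (by norm_num) (by norm_num)] at this
  simpa [logSqIntegral] using this

lemma lintegral_log_norm_sub_sq_le {a : ℂ} {A : ℝ} (ha : ‖a‖ ≤ A) (M : ℝ) :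
    ∫⁻ z in Metric.ball (0 : ℂ) M, ‖Real.log ‖z - a‖‖ₑ ^ 2 ≤ logSqIntegral (M + A) := by
  rw [logSqIntegral, ← lintegral_indicator measurableSet_ball,
    ← lintegral_indicator measurableSet_ball]
  refine le_trans (lintegral_mono fun c => ?_) (lintegral_sub_right_eq_self _ a).le
  by_cases hc : c ∈ Metric.ball (0 : ℂ) M
  · rw [Set.indicator_of_mem hc, Set.indicator_of_mem]
    rw [mem_ball_zero_iff] at hc ⊢
    linarith [norm_sub_le c a]
  · rw [Set.indicator_of_notMem hc]
    positivity

lemma memLp_log_norm_sub (a : ℂ) (M : ℝ) :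
    MemLp (fun z : ℂ => Real.log ‖z - a‖) 2 (volume.restrict (Metric.ball 0 M)) := by
  refine ⟨Measurable.aestronglyMeasurable (by fun_prop), ?_⟩
  rw [eLpNorm_lt_top_iff_lintegral_rpow_enorm_lt_top (by norm_num) (by norm_num)]
  simpa using (lintegral_log_norm_sub_sq_le le_rfl M).trans_lt (logSqIntegral_lt_top (M + ‖a‖))

/-- Cauchy–Schwarz over the `n` summands, then `(x - y)² ≤ 2x² + 2y²`. -/
lemma potentialDiff_sq_le {n : ℕ} (a b : Fin n → ℂ) (z : ℂ) :
    ‖potentialDiff a b z‖ₑ ^ 2 ≤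
      2 * n * ∑ i, (‖Real.log ‖z - a i‖‖ₑ ^ 2 + ‖Real.log ‖z - b i‖‖ₑ ^ 2) := by
  have he : ∀ x : ℝ, ‖x‖ₑ ^ 2 = ENNReal.ofReal (x ^ 2) := fun x => by
    rw [Real.enorm_eq_ofReal_abs, ← ENNReal.ofReal_pow (abs_nonneg x), sq_abs]
  have h2n : (2 * n : ℝ≥0∞) = ENNReal.ofReal (2 * n) := by
    rw [ENNReal.ofReal_mul (by norm_num)]; simp
  simp_rw [he, ← ENNReal.ofReal_add (sq_nonneg _) (sq_nonneg _)]
  rw [← ENNReal.ofReal_sum_of_nonneg fun i _ => by positivity, h2n,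
    ← ENNReal.ofReal_mul (by positivity)]
  refine ENNReal.ofReal_le_ofReal ?_
  have h := sq_sum_le_card_mul_sum_sq (s := Finset.univ)
    (f := fun i => Real.log ‖z - a i‖ - Real.log ‖z - b i‖)
  rw [Finset.card_univ, Fintype.card_fin] at h
  refine h.trans ?_
  rw [mul_comm 2, mul_assoc]
  refine mul_le_mul_of_nonneg_left ?_ (by positivity)
  rw [Finset.mul_sum]
  refine Finset.sum_le_sum fun i _ => ?_
  nlinarith [sq_nonneg (Real.log ‖z - a i‖ + Real.log ‖z - b i‖)]

lemma lintegral_potentialDiff_sq_le {n : ℕ} {a b : Fin n → ℂ} {A : ℝ} (ha : ∀ i, ‖a i‖ ≤ A)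
    (hb : ∀ i, ‖b i‖ ≤ A) (M : ℝ) :
    ∫⁻ z in Metric.ball (0 : ℂ) M, ‖potentialDiff a b z‖ₑ ^ 2 ≤
      4 * n ^ 2 * logSqIntegral (M + A) := by
  calc _ ≤ ∫⁻ z in Metric.ball (0 : ℂ) M,
        2 * n * ∑ i, (‖Real.log ‖z - a i‖‖ₑ ^ 2 + ‖Real.log ‖z - b i‖‖ₑ ^ 2) :=
        lintegral_mono fun z => potentialDiff_sq_le a b z
    _ = 2 * n * ∑ i, ((∫⁻ z in Metric.ball (0 : ℂ) M, ‖Real.log ‖z - a i‖‖ₑ ^ 2) +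
          ∫⁻ z in Metric.ball (0 : ℂ) M, ‖Real.log ‖z - b i‖‖ₑ ^ 2) := by
        rw [lintegral_const_mul _ (by fun_prop), lintegral_finsetSum _ fun i _ => by fun_prop]
        congr 2 with i
        rw [lintegral_add_left (by fun_prop)]
    _ ≤ 2 * n * ∑ i : Fin n, (logSqIntegral (M + A) + logSqIntegral (M + A)) := by
        gcongr with i
        · exact lintegral_log_norm_sub_sq_le (ha i) M
        · exact lintegral_log_norm_sub_sq_le (hb i) M
    _ = 4 * n ^ 2 * logSqIntegral (M + A) := by
        simp only [Finset.sum_const, Finset.card_univ, Fintype.card_fin, nsmul_eq_mul]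
        ring

/-! ### Annular measures: a single random factor `1 - z / v` -/

/-- A rotation invariant probability measure on the annulus `ρ ≤ ‖v‖ ≤ R`, `1 < ρ`, with a bounded
density. -/
structure IsAnnular (μ : Measure ℂ) (K : ℝ≥0∞) (ρ R : ℝ) : Prop where
  isProbabilityMeasure : IsProbabilityMeasure μ
  one_lt : 1 < ρ
  ne_top : K ≠ ∞
  le_smul : μ ≤ K • volume
  ae_mem : ∀ᵐ v ∂μ, ρ ≤ ‖v‖ ∧ ‖v‖ ≤ R
  measurePreserving : ∀ c : Circle, MeasurePreserving (fun v => (c : ℂ) * v) μ μ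

namespace IsAnnular

variable {μ : Measure ℂ} {K : ℝ≥0∞} {ρ R : ℝ}

lemma absolutelyContinuous (h : IsAnnular μ K ρ R) : μ ≪ volume :=
  (Measure.absolutelyContinuous_of_le h.le_smul).trans Measure.smul_absolutelyContinuous

lemma ae_ne (h : IsAnnular μ K ρ R) (z : ℂ) : ∀ᵐ v ∂μ, v ≠ z :=
  h.absolutelyContinuous.ae_le (Measure.ae_ne volume z)

lemma one_lt_radius (h : IsAnnular μ K ρ R) : 1 < R := by
  have := h.isProbabilityMeasure
  obtain ⟨v, hv1, hv2⟩ := h.ae_mem.exists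
  linarith [h.one_lt]

lemma le_smul_restrict (h : IsAnnular μ K ρ R) :
    μ ≤ K • volume.restrict (Metric.ball 0 (R + 1)) := by
  have : μ.restrict (Metric.ball 0 (R + 1)) = μ := by
    refine Measure.restrict_eq_self_of_ae_mem ?_
    filter_upwards [h.ae_mem] with v hv
    rw [mem_ball_zero_iff]; linarith
  rw [← this, ← Measure.restrict_smul]
  exact Measure.restrict_mono le_rfl h.le_smul

lemma log_norm_one_sub_div (h : IsAnnular μ K ρ R) (z : ℂ) :
    (fun v => Real.log ‖v - z‖ - Real.log ‖v - 0‖) =ᵐ[μ] fun v => Real.log ‖1 - z / v‖ := by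
  filter_upwards [h.ae_ne 0, h.ae_ne z] with v h0 hz
  have : 1 - z / v = (v - z) / v := by field_simp
  rw [this, norm_div, sub_zero, Real.log_div (by simpa [sub_eq_zero] using hz) (by simpa using h0)]

lemma memLp_log (h : IsAnnular μ K ρ R) (z : ℂ) :
    MemLp (fun v => Real.log ‖1 - z / v‖) 2 μ :=
  (((memLp_log_norm_sub z _).of_measure_le_smul h.ne_top h.le_smul_restrict).sub
    ((memLp_log_norm_sub 0 _).of_measure_le_smul h.ne_top h.le_smul_restrict)).ae_eq
      (h.log_norm_one_sub_div z)

/-- Rotating `v` leaves the integral unchanged, so it may be averaged over all rotations. For fixed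
`v ≠ 0` the average of `log |e^{iθ} - z / v|` is `log⁺ |z / v| ≥ 0` by Jensen's formula. -/
lemma integral_log_nonneg (h : IsAnnular μ K ρ R) (z : ℂ) :
    0 ≤ ∫ v, Real.log ‖1 - z / v‖ ∂μ := by
  have := h.isProbabilityMeasure
  set F : ℂ → ℝ := fun v => Real.log ‖1 - z / v‖ with hF
  have hFi : Integrable F μ := (h.memLp_log z).integrable (by norm_num)
  have hFm : Measurable F := by fun_prop
  set ν := (volume : Measure ℝ).restrict (Set.Ioc 0 (2 * Real.pi)) with hν
  have hrot : ∀ θ : ℝ, MeasurePreserving (fun v => circleMap 0 1 θ * v) μ μ := fun θ => by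
    simpa [circleMap, Circle.coe_exp] using h.measurePreserving (Circle.exp θ)
  have hint : Integrable (fun q : ℝ × ℂ => F (circleMap 0 1 q.1 * q.2)) (ν.prod μ) := by
    rw [integrable_prod_iff (Measurable.aestronglyMeasurable (by unfold circleMap; fun_prop))]
    refine ⟨ae_of_all _ fun θ => (hrot θ).integrable_comp_of_integrable hFi, ?_⟩
    have : ∀ θ : ℝ, ∫ v, ‖F (circleMap 0 1 θ * v)‖ ∂μ = ∫ v, ‖F v‖ ∂μ := fun θ => by
      have := integral_map (hrot θ).measurable.aemeasurable (μ := μ) (f := fun v => ‖F v‖)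
        (by fun_prop)
      rw [← this, (hrot θ).map_eq]
    simp_rw [this]
    exact integrable_const _
  have h1 : ∀ θ : ℝ, ∫ v, F (circleMap 0 1 θ * v) ∂μ = ∫ v, F v ∂μ := fun θ => by
    rw [← integral_map (hrot θ).measurable.aemeasurable (by fun_prop), (hrot θ).map_eq]
  have h2 : ∀ᵐ v ∂μ, 0 ≤ ∫ θ, F (circleMap 0 1 θ * v) ∂ν := by
    filter_upwards [h.ae_ne 0] with v hv
    have h3 : ∀ θ : ℝ, F (circleMap 0 1 θ * v) = Real.log ‖circleMap 0 1 θ - z / v‖ := fun θ => by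
      have hθ : circleMap 0 1 θ ≠ 0 := circleMap_ne_center one_ne_zero
      have h4 : circleMap 0 1 θ * (1 - z / (circleMap 0 1 θ * v)) = circleMap 0 1 θ - z / v := by
        field_simp
      rw [← h4, norm_mul]
      simp [hF]
    have h5 := circleAverage_log_norm_sub_const_eq_posLog (a := z / v)
    rw [Real.circleAverage_def, intervalIntegral.integral_of_le (by positivity), smul_eq_mul] at h5
    simp_rw [h3]
    have h6 := Real.posLog_nonneg (x := ‖z / v‖)
    rw [← h5] at h6
    exact nonneg_of_mul_nonneg_right h6 (by positivity)
  have h3 : 0 ≤ ∫ θ, ∫ v, F (circleMap 0 1 θ * v) ∂μ ∂ν := by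
    rw [integral_integral_swap hint]
    exact integral_nonneg_of_ae h2
  simp_rw [h1] at h3
  rw [integral_const, smul_eq_mul] at h3
  refine nonneg_of_mul_nonneg_right h3 ?_
  simp [hν, Measure.real, ENNReal.toReal_ofReal Real.pi_pos.le, Real.pi_pos]

/-- Anti-concentration of `1 - z / v`. -/
lemma measure_norm_sub_le (h : IsAnnular μ K ρ R) {z : ℂ} (hz : z ≠ 0) (u : ℂ) {t : ℝ}
    (ht : 0 ≤ t) :
    μ {v | ‖(1 - z / v) - u‖ ≤ t} ≤ K * volume (Metric.closedBall (0 : ℂ) (2 * t * R ^ 2 / ‖z‖)) := by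
  set T : Set ℂ := {v | ‖(1 - z / v) - u‖ ≤ t} ∩ {v | ρ ≤ ‖v‖ ∧ ‖v‖ ≤ R} with hT
  have hμT : μ {v | ‖(1 - z / v) - u‖ ≤ t} = μ T := by
    refine measure_congr ?_
    filter_upwards [h.ae_mem] with v hv
    exact propext ⟨fun hh => ⟨hh, hv⟩, fun hh => hh.1⟩
  rw [hμT]
  rcases T.eq_empty_or_nonempty with he | ⟨v₀, hv₀⟩
  · simp [he]
  have hρ := h.one_lt
  -- The ball is centred at a point of `T` itself: two points of `T` satisfy `|z / v₀ - z / v| ≤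
  -- 2t`, and `v - v₀ = (z / v₀ - z / v) v v₀ / z`.
  have hsub : T ⊆ Metric.closedBall v₀ (2 * t * R ^ 2 / ‖z‖) := by
    intro v hv
    have hv1 : v ≠ 0 := norm_pos_iff.1 (by linarith [hv.2.1])
    have hv01 : v₀ ≠ 0 := norm_pos_iff.1 (by linarith [hv₀.2.1])
    have hz' : 0 < ‖z‖ := norm_pos_iff.2 hz
    have h1 : ‖z / v₀ - z / v‖ ≤ 2 * t := by
      have : z / v₀ - z / v = ((1 - z / v) - u) - ((1 - z / v₀) - u) := by ring
      rw [this]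
      have := norm_sub_le ((1 - z / v) - u) ((1 - z / v₀) - u)
      linarith [hv.1.out, hv₀.1.out]
    have h2 : v - v₀ = (z / v₀ - z / v) * (v * v₀) / z := by field_simp
    rw [mem_closedBall_iff_norm, h2, norm_div, norm_mul, norm_mul, pow_two]
    have hR := h.one_lt_radius
    gcongr
    · exact hv.2.2
    · exact hv₀.2.2
  calc μ T ≤ (K • volume) T := h.le_smul T
    _ ≤ K * volume (Metric.closedBall v₀ (2 * t * R ^ 2 / ‖z‖)) := by
        rw [Measure.smul_apply, smul_eq_mul]; gcongr
    _ = _ := by rw [Measure.addHaar_closedBall_center]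

end IsAnnular

/-! ### Independent samples and the law of large numbers -/

lemma ae_pi_of_ae {μ : Measure ℂ} [IsProbabilityMeasure μ] {q : ℂ → Prop} (h : ∀ᵐ v ∂μ, q v)
    (n : ℕ) : ∀ᵐ v ∂Measure.pi fun _ : Fin n => μ, ∀ i, q (v i) :=
  ae_all_iff.2 fun i => (measurePreserving_eval (fun _ : Fin n => μ) i).quasiMeasurePreserving.ae h

/-- The weak law of large numbers for square integrable functions of i.i.d. random points. -/
lemma tendsto_measure_pi_abs_sum_sub {μ : Measure ℂ} [IsProbabilityMeasure μ] {X : ℂ → ℝ}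
    (hX : MemLp X 2 μ) {ε : ℝ} (hε : 0 < ε) :
    Tendsto (fun n : ℕ => Measure.pi (fun _ : Fin n => μ)
      {v | ε * n ≤ |∑ i, X (v i) - n * ∫ x, X x ∂μ|}) atTop (𝓝 0) := by
  have hlim : Tendsto (fun n : ℕ => ENNReal.ofReal (variance X μ / ε ^ 2 / n)) atTop (𝓝 0) := by
    have := ENNReal.tendsto_ofReal
      (tendsto_const_nhds (x := variance X μ / ε ^ 2).div_atTop tendsto_natCast_atTop_atTop)
    simpa using this
  refine tendsto_of_tendsto_of_tendsto_of_le_of_le' tendsto_const_nhds hlim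
    (Eventually.of_forall fun _ => bot_le) ?_
  filter_upwards [eventually_ge_atTop 1] with n hn
  have hn0 : (0 : ℝ) < n := by exact_mod_cast hn
  have hXi : ∀ i : Fin n, MemLp (fun v : Fin n → ℂ => X (v i)) 2 (Measure.pi fun _ => μ) :=
    fun i => hX.comp_measurePreserving (measurePreserving_eval _ i)
  have hmem : MemLp (∑ i, fun v : Fin n → ℂ => X (v i)) 2 (Measure.pi fun _ => μ) :=
    memLp_finsetSum' _ fun i _ => hXi i
  have hmean : ∫ v, (∑ i, fun v : Fin n → ℂ => X (v i)) v ∂(Measure.pi fun _ => μ) =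
      n * ∫ x, X x ∂μ := by
    simp only [Finset.sum_apply]
    rw [integral_finsetSum _ fun i _ => (hXi i).integrable (by norm_num)]
    have : ∀ i : Fin n, ∫ v, X (v i) ∂(Measure.pi fun _ => μ) = ∫ x, X x ∂μ := fun i =>
      integral_comp_eval (μ := fun _ : Fin n => μ) (i := i) (f := X) hX.aestronglyMeasurable
    simp [this]
  have h := meas_ge_le_variance_div_sq hmem (mul_pos hε hn0)
  rw [hmean, variance_sum_pi fun _ => hX] at h
  simp only [Finset.sum_apply] at h
  refine h.trans (ENNReal.ofReal_le_ofReal (le_of_eq ?_))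
  simp only [Finset.sum_const, Finset.card_univ, Fintype.card_fin, nsmul_eq_mul]
  field_simp

/-! ### The log ratio at a fixed point is `o(n)` in probability -/

/-- `log |p(z) - p(0)| - log |p(z)|` for the monic polynomial `p` with roots `v`. -/
noncomputable def logRatio {n : ℕ} (v : Fin n → ℂ) (z : ℂ) : ℝ :=
  Real.log ‖(subValueAtZero (polyOfRoots v)).eval z‖ - Real.log ‖(polyOfRoots v).eval z‖

lemma eval_polyOfRoots {n : ℕ} (v : Fin n → ℂ) (z : ℂ) :
    (polyOfRoots v).eval z = ∏ i, (z - v i) := by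
  simp [polyOfRoots, Polynomial.eval_prod]

lemma eval_subValueAtZero (p : ℂ[X]) (z : ℂ) :
    (subValueAtZero p).eval z = p.eval z - p.eval 0 := by
  simp [subValueAtZero]

lemma logRatio_eq {n : ℕ} {v : Fin n → ℂ} {z : ℂ} (h0 : ∀ i, v i ≠ 0) (hz : ∀ i, v i ≠ z)
    (hne : (1 - (∏ i, (1 - z / v i))⁻¹) ≠ 0) :
    logRatio v z = Real.log ‖1 - (∏ i, (1 - z / v i))⁻¹‖ := by
  have hp : (polyOfRoots v).eval z ≠ 0 := by
    rw [eval_polyOfRoots]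
    exact Finset.prod_ne_zero_iff.2 fun i _ => sub_ne_zero.2 (hz i).symm
  have h : (subValueAtZero (polyOfRoots v)).eval z =
      (1 - (∏ i, (1 - z / v i))⁻¹) * (polyOfRoots v).eval z := by
    rw [eval_subValueAtZero, sub_mul, one_mul, eval_polyOfRoots, eval_polyOfRoots,
      ← Finset.prod_inv_distrib, ← Finset.prod_mul_distrib]
    congr 1
    refine Finset.prod_congr rfl fun i _ => ?_
    have h1 := h0 i
    have h2 : z - v i ≠ 0 := sub_ne_zero.2 (hz i).symm
    have h3 : v i - z ≠ 0 := sub_ne_zero.2 (hz i)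
    have h4 : 1 - z / v i = (v i - z) / v i := by field_simp
    rw [h4]
    field_simp
    ring
  rw [logRatio, h, norm_mul, Real.log_mul (norm_ne_zero_iff.2 hne) (norm_ne_zero_iff.2 hp)]
  ring

namespace IsAnnular

variable {μ : Measure ℂ} {K : ℝ≥0∞} {ρ R : ℝ}

/-- The small ball bound for a product of i.i.d. factors, by conditioning on all factors but one. -/
lemma measure_pi_norm_sub_le (h : IsAnnular μ K ρ R) {z : ℂ} (hz : z ≠ 0) {t : ℝ} (ht : 0 ≤ t)
    (m : ℕ) :
    Measure.pi (fun _ : Fin (m + 1) => μ)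
      {v | ‖(1 - z / v 0) - (∏ i : Fin m, (1 - z / v i.succ))⁻¹‖ ≤ t} ≤
      K * volume (Metric.closedBall (0 : ℂ) (2 * t * R ^ 2 / ‖z‖)) := by
  have := h.isProbabilityMeasure
  set s : Set (ℂ × (Fin m → ℂ)) :=
    {q | ‖(1 - z / q.1) - (∏ i : Fin m, (1 - z / q.2 i))⁻¹‖ ≤ t} with hs
  have hsm : MeasurableSet s := measurableSet_le (by fun_prop) (by fun_prop)
  have hmp := measurePreserving_piFinSuccAbove (fun _ : Fin (m + 1) => μ) 0
  have hset : {v : Fin (m + 1) → ℂ |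
      ‖(1 - z / v 0) - (∏ i : Fin m, (1 - z / v i.succ))⁻¹‖ ≤ t} =
      MeasurableEquiv.piFinSuccAbove (fun _ => ℂ) 0 ⁻¹' s := by
    ext v
    simp [hs, Fin.tail]
  rw [hset, hmp.measure_preimage hsm.nullMeasurableSet, Measure.prod_apply_symm hsm]
  have hq : ∀ q : Fin m → ℂ, μ ((fun x => (x, q)) ⁻¹' s) ≤
      K * volume (Metric.closedBall (0 : ℂ) (2 * t * R ^ 2 / ‖z‖)) := fun q => by
    have hsec : (fun x => (x, q)) ⁻¹' s =
        {v | ‖(1 - z / v) - (∏ i : Fin m, (1 - z / q i))⁻¹‖ ≤ t} := by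
      ext v
      simp only [hs, Set.mem_preimage, Set.mem_ofPred_eq]
    rw [hsec]
    exact h.measure_norm_sub_le hz _ ht
  refine (lintegral_mono hq).trans ?_
  rw [lintegral_const, measure_univ, mul_one]

lemma tendsto_measure_sum_log_le (h : IsAnnular μ K ρ R) (z : ℂ) {ε : ℝ} (hε : 0 < ε) :
    Tendsto (fun n : ℕ => Measure.pi (fun _ : Fin n => μ)
      {v | ∑ i, Real.log ‖1 - z / v i‖ ≤ -(ε * n)}) atTop (𝓝 0) := by
  have := h.isProbabilityMeasure
  refine tendsto_of_tendsto_of_tendsto_of_le_of_le tendsto_const_nhds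
    (tendsto_measure_pi_abs_sum_sub (h.memLp_log z) hε) (fun _ => bot_le)
    fun n => measure_mono fun v hv => ?_
  have h1 : 0 ≤ n * ∫ v, Real.log ‖1 - z / v‖ ∂μ := mul_nonneg n.cast_nonneg (h.integral_log_nonneg z)
  rw [Set.mem_ofPred_eq, le_abs]
  right
  linarith [hv.out]

end IsAnnular

/-- Here `u` is one factor and `Q` the product of the others. The upper bound is `1 + e^x ≤ e^{2x}`.
For the lower one, if `1 - (uQ)⁻¹` were smaller than `e^{-2x}` then `|uQ| ≤ 2`, and `u - Q⁻¹ = uQ (1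
- (uQ)⁻¹) Q⁻¹` would have modulus at most `2 e^{-x}`, against `h3`. -/
lemma abs_log_norm_one_sub_inv_le {u Q : ℂ} {x y : ℝ} (hu : u ≠ 0) (hQ : Q ≠ 0)
    (hx : Real.log 2 ≤ x) (hy : y ≤ x) (h1 : -x < Real.log ‖u * Q‖) (h2 : -y < Real.log ‖Q‖)
    (h3 : 2 * Real.exp (-x) < ‖u - Q⁻¹‖) :
    1 - (u * Q)⁻¹ ≠ 0 ∧ |Real.log ‖1 - (u * Q)⁻¹‖| ≤ 2 * x := by
  have hw : u * Q ≠ 0 := mul_ne_zero hu hQ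
  have hw' : 0 < ‖u * Q‖ := norm_pos_iff.2 hw
  have hQ' : 0 < ‖Q‖ := norm_pos_iff.2 hQ
  have hx2 : 2 ≤ Real.exp x := by rwa [← Real.log_le_iff_le_exp two_pos]
  have hxx : Real.exp (2 * x) = Real.exp x * Real.exp x := by rw [← Real.exp_add]; ring_nf
  have hw1 : ‖(u * Q)⁻¹‖ ≤ Real.exp x := by
    rw [norm_inv, ← Real.log_le_iff_le_exp (by positivity), Real.log_inv]
    linarith
  have hQ1 : ‖Q⁻¹‖ ≤ Real.exp x := by
    rw [norm_inv, ← Real.log_le_iff_le_exp (by positivity), Real.log_inv]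
    linarith
  have hup : ‖1 - (u * Q)⁻¹‖ ≤ Real.exp (2 * x) := by
    have := norm_sub_le (1 : ℂ) (u * Q)⁻¹
    rw [norm_one] at this
    nlinarith
  have hlow : Real.exp (-(2 * x)) ≤ ‖1 - (u * Q)⁻¹‖ := by
    by_contra! hlt
    have he : Real.exp (-(2 * x)) ≤ 1 / 2 := by
      rw [Real.exp_neg, hxx, one_div]
      exact inv_anti₀ two_pos (by nlinarith)
    have h4 : 1 / 2 ≤ ‖(u * Q)⁻¹‖ := by
      have := norm_sub_norm_le (1 : ℂ) (u * Q)⁻¹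
      rw [norm_one] at this
      linarith
    have h5 : ‖u * Q‖ ≤ 2 := by
      rw [norm_inv, one_div] at h4
      exact (inv_le_inv₀ two_pos hw').1 h4
    have h6 : u - Q⁻¹ = u * Q * (1 - (u * Q)⁻¹) * Q⁻¹ := by field_simp
    have h7 : ‖u - Q⁻¹‖ ≤ 2 * Real.exp (-(2 * x)) * Real.exp x := by
      rw [h6, norm_mul, norm_mul]
      gcongr
    have h8 : Real.exp (-(2 * x)) * Real.exp x = Real.exp (-x) := by
      rw [← Real.exp_add]; ring_nf
    rw [mul_assoc, h8] at h7
    linarith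
  have hpos : 0 < ‖1 - (u * Q)⁻¹‖ := (Real.exp_pos _).trans_le hlow
  refine ⟨norm_pos_iff.1 hpos, abs_le.2 ⟨?_, ?_⟩⟩
  · rwa [Real.le_log_iff_exp_le hpos]
  · rwa [Real.log_le_iff_le_exp hpos]

namespace IsAnnular

variable {μ : Measure ℂ} {K : ℝ≥0∞} {ρ R : ℝ}

lemma tendsto_measure_logRatio (h : IsAnnular μ K ρ R) {z : ℂ} (hz : z ≠ 0) {ε : ℝ} (hε : 0 < ε) :
    Tendsto (fun n : ℕ => Measure.pi (fun _ : Fin n => μ) {v | ε * n < |logRatio v z|})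
      atTop (𝓝 0) := by
  have := h.isProbabilityMeasure
  -- With `m + 1` factors, one can be split off for the anti-concentration bound.
  rw [← tendsto_add_atTop_iff_nat 1]
  set b : ℕ → ℝ≥0∞ := fun m =>
    K * volume (Metric.closedBall (0 : ℂ)
      (2 * (2 * Real.exp (-(ε / 2 * (m + 1 : ℕ)))) * R ^ 2 / ‖z‖)) with hb
  have hb0 : Tendsto b atTop (𝓝 0) := by
    have h1 : Tendsto (fun m : ℕ => ε / 2 * ((m + 1 : ℕ) : ℝ)) atTop atTop :=
      (tendsto_natCast_atTop_atTop.comp (tendsto_add_atTop_nat 1)).const_mul_atTop (by positivity)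
    have h2 := Real.tendsto_exp_neg_atTop_nhds_zero.comp h1
    have h3 : Tendsto (fun m : ℕ => 2 * (2 * Real.exp (-(ε / 2 * (m + 1 : ℕ)))) * R ^ 2 / ‖z‖)
        atTop (𝓝 0) := by
      have := (((h2.const_mul 2).const_mul 2).mul_const (R ^ 2)).div_const ‖z‖
      simpa using this
    have h4 := ENNReal.Tendsto.pow (n := 2) (ENNReal.tendsto_ofReal h3)
    simp only [hb, Complex.volume_closedBall]
    have h5 := ENNReal.Tendsto.const_mul (ENNReal.Tendsto.mul_const (b := (NNReal.pi : ℝ≥0∞)) h4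
      (Or.inr (by simp))) (Or.inr h.ne_top)
    simpa using h5
  have hlim := (((h.tendsto_measure_sum_log_le z (half_pos hε)).comp
    (tendsto_add_atTop_nat 1)).add (h.tendsto_measure_sum_log_le z (half_pos hε))).add hb0
  simp only [add_zero] at hlim
  have hlarge : ∀ᶠ m : ℕ in atTop, Real.log 2 ≤ ε / 2 * ((m + 1 : ℕ) : ℝ) :=
    ((tendsto_natCast_atTop_atTop.comp (tendsto_add_atTop_nat 1)).const_mul_atTop
      (by positivity : 0 < ε / 2)).eventually_ge_atTop _
  refine tendsto_of_tendsto_of_tendsto_of_le_of_le' tendsto_const_nhds hlim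
    (Eventually.of_forall fun _ => bot_le) ?_
  filter_upwards [hlarge] with m hm
  set P := Measure.pi (fun _ : Fin (m + 1) => μ) with hP
  set E₁ : Set (Fin (m + 1) → ℂ) :=
    {v | ∑ i, Real.log ‖1 - z / v i‖ ≤ -(ε / 2 * (m + 1 : ℕ))} with hE₁
  set E₂ : Set (Fin (m + 1) → ℂ) :=
    {v | ∑ i : Fin m, Real.log ‖1 - z / v i.succ‖ ≤ -(ε / 2 * m)} with hE₂
  set E₃ : Set (Fin (m + 1) → ℂ) :=
    {v | ‖(1 - z / v 0) - (∏ i : Fin m, (1 - z / v i.succ))⁻¹‖ ≤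
      2 * Real.exp (-(ε / 2 * (m + 1 : ℕ)))} with hE₃
  -- `E₂` depends only on the last `m` coordinates, so the law of large numbers for `m` samples
  -- applies.
  have hPE₂ : P E₂ = Measure.pi (fun _ : Fin m => μ)
      {v | ∑ i, Real.log ‖1 - z / v i‖ ≤ -(ε / 2 * m)} := by
    have hmp := measurePreserving_snd.comp
      (measurePreserving_piFinSuccAbove (fun _ : Fin (m + 1) => μ) 0)
    have hms : MeasurableSet {v : Fin m → ℂ | ∑ i, Real.log ‖1 - z / v i‖ ≤ -(ε / 2 * m)} :=
      measurableSet_le (by fun_prop) (by fun_prop)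
    exact hmp.measure_preimage hms.nullMeasurableSet
  have hPE₃ : P E₃ ≤ b m := h.measure_pi_norm_sub_le hz (by positivity) m
  have hsub : P {v | ε * (m + 1 : ℕ) < |logRatio v z|} ≤ P (E₁ ∪ E₂ ∪ E₃) := by
    refine measure_mono_ae ?_
    filter_upwards [ae_pi_of_ae (h.ae_ne 0) (m + 1), ae_pi_of_ae (h.ae_ne z) (m + 1)]
      with v h0 hvz hv
    by_contra hcon
    replace hcon : v ∉ E₁ ∪ E₂ ∪ E₃ := hcon
    rw [Set.mem_union, Set.mem_union, not_or, not_or, hE₁, hE₂, hE₃, Set.mem_ofPred_eq,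
      Set.mem_ofPred_eq, Set.mem_ofPred_eq, not_le, not_le, not_le] at hcon
    obtain ⟨⟨c1, c2⟩, c3⟩ := hcon
    replace hv : ε * (m + 1 : ℕ) < |logRatio v z| := hv
    have hne : ∀ i, 1 - z / v i ≠ 0 := fun i hi => hvz i (by
      have := h0 i
      rw [sub_eq_zero, eq_div_iff this, one_mul] at hi
      exact hi)
    have hprod : ∏ i, (1 - z / v i) = (1 - z / v 0) * ∏ i : Fin m, (1 - z / v i.succ) :=
      Fin.prod_univ_succ _
    have hl1 : ∑ i, Real.log ‖1 - z / v i‖ = Real.log ‖∏ i, (1 - z / v i)‖ := by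
      rw [norm_prod, Real.log_prod fun i _ => norm_ne_zero_iff.2 (hne i)]
    have hl2 : ∑ i : Fin m, Real.log ‖1 - z / v i.succ‖ =
        Real.log ‖∏ i : Fin m, (1 - z / v i.succ)‖ := by
      rw [norm_prod, Real.log_prod fun i _ => norm_ne_zero_iff.2 (hne _)]
    rw [hl1, hprod] at c1
    rw [hl2] at c2
    obtain ⟨d1, d2⟩ := abs_log_norm_one_sub_inv_le (hne 0)
      (Finset.prod_ne_zero_iff.2 fun i _ => hne _) hm (y := ε / 2 * m)
      (by push_cast; nlinarith) c1 c2 c3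
    rw [← hprod] at d1 d2
    rw [← logRatio_eq h0 hvz d1] at d2
    linarith
  refine hsub.trans ((measure_union_le _ _).trans (add_le_add ((measure_union_le _ _).trans ?_) hPE₃))
  rw [hPE₂]
  rfl

end IsAnnular

/-! ### Number, enumeration and location of the roots of `p - p(0)` -/

lemma monic_polyOfRoots {n : ℕ} (v : Fin n → ℂ) : (polyOfRoots v).Monic :=
  Polynomial.monic_prod_of_monic _ _ fun i _ => Polynomial.monic_X_sub_C (v i)

lemma natDegree_polyOfRoots {n : ℕ} (v : Fin n → ℂ) : (polyOfRoots v).natDegree = n := by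
  simp [polyOfRoots, Polynomial.natDegree_finsetProd_X_sub_C_eq_card]

lemma natDegree_subValueAtZero {n : ℕ} (v : Fin n → ℂ) :
    (subValueAtZero (polyOfRoots v)).natDegree = n := by
  rw [subValueAtZero, Polynomial.natDegree_sub_C, natDegree_polyOfRoots]

lemma monic_subValueAtZero {n : ℕ} (hn : 1 ≤ n) (v : Fin n → ℂ) :
    (subValueAtZero (polyOfRoots v)).Monic := by
  refine (monic_polyOfRoots v).sub_of_left ?_
  refine Polynomial.degree_C_le.trans_lt ?_
  rw [Polynomial.degree_eq_natDegree (monic_polyOfRoots v).ne_zero, natDegree_polyOfRoots]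
  exact_mod_cast hn

lemma card_roots_subValueAtZero {n : ℕ} (v : Fin n → ℂ) :
    (subValueAtZero (polyOfRoots v)).roots.card = n := by
  rw [← (IsAlgClosed.splits _).natDegree_eq_card_roots, natDegree_subValueAtZero]

lemma exists_roots_eq_map {n : ℕ} (v : Fin n → ℂ) :
    ∃ a : Fin n → ℂ, (subValueAtZero (polyOfRoots v)).roots = Multiset.map a Finset.univ.val := by
  obtain ⟨l, hl⟩ := Quotient.exists_rep (subValueAtZero (polyOfRoots v)).roots
  have hlen : l.length = n := by
    rw [← card_roots_subValueAtZero v, ← hl]; rfl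
  subst hlen
  refine ⟨l.get, ?_⟩
  rw [← hl]
  simp [Fin.univ_def]

lemma eval_subValueAtZero_eq_prod {n : ℕ} (hn : 1 ≤ n) {v a : Fin n → ℂ}
    (ha : (subValueAtZero (polyOfRoots v)).roots = Multiset.map a Finset.univ.val) (z : ℂ) :
    (subValueAtZero (polyOfRoots v)).eval z = ∏ i, (z - a i) := by
  have h := (IsAlgClosed.splits (subValueAtZero (polyOfRoots v))).eq_prod_roots
  rw [(monic_subValueAtZero hn v).leadingCoeff, ha] at h
  rw [h, Multiset.map_map, Polynomial.C_1, one_mul]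
  change Polynomial.eval z (∏ i, (Polynomial.X - Polynomial.C (a i))) = _
  exact eval_polyOfRoots a z

/-- If `|α| > 2R`, then `|α - vᵢ| > R ≥ |vᵢ|` for every `i`, hence `|p(α)| > |p(0)|`. -/
lemma norm_le_of_mem_roots {n : ℕ} {v : Fin n → ℂ} {R : ℝ} (h0 : ∀ i, v i ≠ 0)
    (hR : ∀ i, ‖v i‖ ≤ R) {α : ℂ} (hα : α ∈ (subValueAtZero (polyOfRoots v)).roots) :
    ‖α‖ ≤ 2 * R := by
  by_contra! hlt
  have hroot := (Polynomial.mem_roots'.1 hα).2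
  have hn : (Finset.univ : Finset (Fin n)).Nonempty := by
    rw [Finset.univ_nonempty_iff]
    by_contra hempty
    rw [not_nonempty_iff] at hempty
    refine (Polynomial.mem_roots'.1 hα).1 ?_
    simp [subValueAtZero, polyOfRoots]
  rw [Polynomial.IsRoot, eval_subValueAtZero, eval_polyOfRoots, eval_polyOfRoots, sub_eq_zero] at hroot
  have h1 := congrArg norm hroot
  rw [norm_prod, norm_prod] at h1
  refine (Finset.prod_lt_prod_of_nonempty (fun i _ => ?_) (fun i _ => ?_) hn).ne' h1
  · simpa using h0 i
  · have := norm_sub_norm_le α (v i)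
    have := hR i
    rw [zero_sub, norm_neg]
    linarith

lemma ae_logRatio_eq_potentialDiff {n : ℕ} {v a : Fin n → ℂ}
    (ha : (subValueAtZero (polyOfRoots v)).roots = Multiset.map a Finset.univ.val) :
    ∀ᵐ z, logRatio v z = potentialDiff a v z := by
  rcases Nat.eq_zero_or_pos n with rfl | hn
  · exact ae_of_all _ fun z => by simp [logRatio, potentialDiff, subValueAtZero, polyOfRoots]
  have h1 : ∀ᵐ z : ℂ, ∀ i, z ≠ a i := ae_all_iff.2 fun i => Measure.ae_ne volume (a i)
  have h2 : ∀ᵐ z : ℂ, ∀ i, z ≠ v i := ae_all_iff.2 fun i => Measure.ae_ne volume (v i)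
  filter_upwards [h1, h2] with z hz1 hz2
  rw [logRatio, eval_subValueAtZero_eq_prod hn ha, eval_polyOfRoots, norm_prod, norm_prod,
    Real.log_prod fun i _ => norm_ne_zero_iff.2 (sub_ne_zero.2 (hz1 i)),
    Real.log_prod fun i _ => norm_ne_zero_iff.2 (sub_ne_zero.2 (hz2 i)), potentialDiff,
    Finset.sum_sub_distrib]

lemma measurable_logRatio (n : ℕ) :
    Measurable fun q : (Fin n → ℂ) × ℂ => logRatio q.1 q.2 := by
  simp only [logRatio, eval_subValueAtZero, eval_polyOfRoots]
  fun_prop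

/-! ### From pointwise to `L¹` bounds, and the limit law of the roots -/

/-- Where `|T| > t`, use `|T| ≤ s T² + s⁻¹`. With `t` of order `n` and `s` of order `1 / n`, the
`L²` bound handles the middle term, and the last is `n` times the size of the exceptional set. -/
lemma enorm_le_truncation (T : ℝ) {s t : ℝ} (hs : 0 < s) (ht : 0 < t) :
    ‖T‖ₑ ≤ ENNReal.ofReal t + ENNReal.ofReal s * ‖T‖ₑ ^ 2 +
      ENNReal.ofReal s⁻¹ * {x : ℝ | t < |x|}.indicator 1 T := by
  rw [Real.enorm_eq_ofReal_abs, ← ENNReal.ofReal_pow (abs_nonneg T), sq_abs,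
    ← ENNReal.ofReal_mul hs.le, ← ENNReal.ofReal_add ht.le (by positivity)]
  by_cases hT : t < |T|
  · rw [Set.indicator_of_mem (by exact hT), Pi.one_apply, mul_one,
      ← ENNReal.ofReal_add (by positivity) (by positivity)]
    refine ENNReal.ofReal_le_ofReal ?_
    have h1 : |T| ≤ s * T ^ 2 + s⁻¹ := by
      rw [← sq_abs]
      have h2 : s * s⁻¹ = 1 := mul_inv_cancel₀ hs.ne'
      have h3 : 0 < s⁻¹ := by positivity
      have h4 : s⁻¹ * (s * |T| - 1) ^ 2 = s * |T| ^ 2 - 2 * |T| + s⁻¹ := by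
        field_simp
        ring
      nlinarith [mul_nonneg h3.le (sq_nonneg (s * |T| - 1)), abs_nonneg T]
    linarith
  · refine (ENNReal.ofReal_le_ofReal ?_).trans le_self_add
    have := mul_nonneg hs.le (sq_nonneg T)
    linarith

namespace IsAnnular

variable {μ : Measure ℂ} {K : ℝ≥0∞} {ρ R : ℝ}

lemma ae_norm_roots_le (h : IsAnnular μ K ρ R) (n : ℕ) :
    ∀ᵐ v ∂Measure.pi (fun _ : Fin n => μ), (∀ i, ‖v i‖ ≤ 2 * R) ∧
      ∀ α ∈ (subValueAtZero (polyOfRoots v)).roots, ‖α‖ ≤ 2 * R := by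
  have := h.isProbabilityMeasure
  have hR := h.one_lt_radius
  filter_upwards [ae_pi_of_ae h.ae_mem n, ae_pi_of_ae (h.ae_ne 0) n] with v hv h0
  exact ⟨fun i => by linarith [(hv i).2], fun α hα =>
    norm_le_of_mem_roots h0 (fun i => (hv i).2) hα⟩

lemma ae_lintegral_logRatio_sq_le (h : IsAnnular μ K ρ R) (M : ℝ) (n : ℕ) :
    ∀ᵐ v ∂Measure.pi (fun _ : Fin n => μ),
      ∫⁻ z in Metric.ball (0 : ℂ) M, ‖logRatio v z‖ₑ ^ 2 ≤
        4 * n ^ 2 * logSqIntegral (M + 2 * R) := by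
  filter_upwards [h.ae_norm_roots_le n] with v hv
  obtain ⟨a, ha⟩ := exists_roots_eq_map v
  have heq : ∫⁻ z in Metric.ball (0 : ℂ) M, ‖logRatio v z‖ₑ ^ 2 =
      ∫⁻ z in Metric.ball (0 : ℂ) M, ‖potentialDiff a v z‖ₑ ^ 2 :=
    lintegral_congr_ae (ae_restrict_of_ae ((ae_logRatio_eq_potentialDiff ha).mono
      fun z hz => by simp only [hz]))
  rw [heq]
  exact lintegral_potentialDiff_sq_le (fun i => hv.2 _ (by simp [ha])) hv.1 M

/-- After Tonelli the integrand in `z` is a probability that tends to `0` for every `z ≠ 0`;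
dominated convergence with bound `1` concludes. -/
lemma tendsto_lintegral_measure_logRatio (h : IsAnnular μ K ρ R) (M : ℝ) {ε : ℝ} (hε : 0 < ε) :
    Tendsto (fun n : ℕ => ∫⁻ v, ∫⁻ z in Metric.ball (0 : ℂ) M,
      {x : ℝ | ε * n < |x|}.indicator 1 (logRatio v z) ∂volume ∂(Measure.pi fun _ : Fin n => μ))
      atTop (𝓝 0) := by
  have := h.isProbabilityMeasure
  have hm : ∀ n : ℕ, Measurable fun q : (Fin n → ℂ) × ℂ =>
      {x : ℝ | ε * n < |x|}.indicator (1 : ℝ → ℝ≥0∞) (logRatio q.1 q.2) := fun n =>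
    (measurable_one.indicator (measurableSet_lt measurable_const (by fun_prop))).comp
      (measurable_logRatio n)
  have hswap : ∀ n : ℕ, ∫⁻ v, ∫⁻ z in Metric.ball (0 : ℂ) M,
      {x : ℝ | ε * n < |x|}.indicator 1 (logRatio v z) ∂volume ∂(Measure.pi fun _ : Fin n => μ) =
      ∫⁻ z in Metric.ball (0 : ℂ) M,
        (Measure.pi fun _ : Fin n => μ) {v | ε * n < |logRatio v z|} := fun n => by
    rw [lintegral_lintegral_swap (hm n).aemeasurable]
    refine lintegral_congr fun z => ?_
    have hms : MeasurableSet {v : Fin n → ℂ | ε * n < |logRatio v z|} :=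
      measurableSet_lt measurable_const
        (((measurable_logRatio n).comp (measurable_id.prodMk measurable_const)).abs)
    rw [← lintegral_indicator_one hms]
    rfl
  simp_rw [hswap]
  have hlim := tendsto_lintegral_of_dominated_convergence (μ := volume.restrict (Metric.ball 0 M))
    (F := fun n z => (Measure.pi fun _ : Fin n => μ) {v | ε * n < |logRatio v z|})
    (f := fun _ => 0) (fun _ => 1) (fun n => ?_) (fun n => ae_of_all _ fun z => prob_le_one)
    ?_ ?_
  · simpa using hlim
  · have hs : MeasurableSet {q : (Fin n → ℂ) × ℂ | ε * n < |logRatio q.1 q.2|} :=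
      measurableSet_lt measurable_const (measurable_logRatio n).abs
    exact measurable_measure_prodMk_right hs
  · rw [setLIntegral_one]
    exact measure_ball_lt_top.ne
  · refine ae_restrict_of_ae ?_
    filter_upwards [Measure.ae_ne volume (0 : ℂ)] with z hz
    exact h.tendsto_measure_logRatio hz hε

lemma tendsto_measure_le_lintegral_logRatio (h : IsAnnular μ K ρ R) (M : ℝ) {ε : ℝ} (hε : 0 < ε) :
    Tendsto (fun n : ℕ => (Measure.pi fun _ : Fin n => μ)
      {v | ENNReal.ofReal (ε * n) ≤ ∫⁻ z in Metric.ball (0 : ℂ) M, ‖logRatio v z‖ₑ})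
      atTop (𝓝 0) := by
  have := h.isProbabilityMeasure
  set V := (volume (Metric.ball (0 : ℂ) M)).toReal with hV
  set C := (logSqIntegral (M + 2 * R)).toReal with hC
  have hVe : volume (Metric.ball (0 : ℂ) M) = ENNReal.ofReal V :=
    (ENNReal.ofReal_toReal measure_ball_lt_top.ne).symm
  have hCe : logSqIntegral (M + 2 * R) = ENNReal.ofReal C :=
    (ENNReal.ofReal_toReal (logSqIntegral_lt_top _).ne).symm
  have hV0 : 0 ≤ V := ENNReal.toReal_nonneg
  have hC0 : 0 ≤ C := ENNReal.toReal_nonneg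
  -- `t` and `s` are chosen so that the first two truncation terms total at most `ε n / 2`. An `L¹`
  -- norm of at least `ε n` then forces the exceptional area `I n v` to be at least `ε s / 2`, which
  -- Markov's inequality makes unlikely.
  set t := ε / (4 * (V + 1)) with ht
  set s := ε / (16 * (C + 1)) with hs
  have ht0 : 0 < t := by positivity
  have hs0 : 0 < s := by positivity
  have hsum : t * V + 4 * s * C ≤ ε / 2 := by
    have h1 : t * V ≤ ε / 4 := by
      rw [ht, div_mul_eq_mul_div, div_le_div_iff₀ (by positivity) (by positivity)]
      nlinarith
    have h2 : 4 * s * C ≤ ε / 4 := by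
      rw [hs, ← mul_div_assoc, div_mul_eq_mul_div, div_le_div_iff₀ (by positivity) (by positivity)]
      nlinarith
    linarith
  set I : ∀ n : ℕ, (Fin n → ℂ) → ℝ≥0∞ := fun n v => ∫⁻ z in Metric.ball (0 : ℂ) M,
      {x : ℝ | t * n < |x|}.indicator 1 (logRatio v z) with hI
  have hIm : ∀ n, Measurable (I n) := fun n =>
    Measurable.lintegral_prod_right' (f := fun q : (Fin n → ℂ) × ℂ =>
      {x : ℝ | t * n < |x|}.indicator (1 : ℝ → ℝ≥0∞) (logRatio q.1 q.2))
      ((measurable_one.indicator (measurableSet_lt measurable_const (by fun_prop))).comp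
      (measurable_logRatio n))
  have hlim := ENNReal.Tendsto.const_mul (a := (ENNReal.ofReal (ε / 2 * s))⁻¹)
    (h.tendsto_lintegral_measure_logRatio M ht0)
    (Or.inr (ENNReal.inv_ne_top.2 (ENNReal.ofReal_pos.2 (by positivity)).ne'))
  rw [mul_zero] at hlim
  refine tendsto_of_tendsto_of_tendsto_of_le_of_le' tendsto_const_nhds hlim
    (Eventually.of_forall fun _ => bot_le) ?_
  filter_upwards [eventually_ge_atTop 1] with n hn
  have hn0 : (0 : ℝ) < n := by exact_mod_cast hn
  refine le_trans (measure_mono_ae ?_) (meas_ge_le_lintegral_div (hIm n).aemeasurable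
    (ENNReal.ofReal_pos.2 (by positivity : 0 < ε / 2 * s)).ne' ENNReal.ofReal_ne_top |>.trans
    (le_of_eq (ENNReal.div_eq_inv_mul)))
  filter_upwards [h.ae_lintegral_logRatio_sq_le M n] with v hv hle
  replace hle : ENNReal.ofReal (ε * n) ≤ ∫⁻ z in Metric.ball (0 : ℂ) M, ‖logRatio v z‖ₑ := hle
  change ENNReal.ofReal (ε / 2 * s) ≤ I n v
  have hlm : Measurable (logRatio v) :=
    (measurable_logRatio n).comp (measurable_const.prodMk measurable_id)
  have hindm : Measurable fun z => {x : ℝ | t * n < |x|}.indicator (1 : ℝ → ℝ≥0∞) (logRatio v z) :=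
    (measurable_one.indicator (measurableSet_lt measurable_const (by fun_prop))).comp hlm
  have hbound : ENNReal.ofReal (ε * n) ≤
      ENNReal.ofReal (ε / 2 * n) + ENNReal.ofReal (n / s) * I n v := by
    calc _ ≤ _ := hle
      _ ≤ ∫⁻ z in Metric.ball (0 : ℂ) M, (ENNReal.ofReal (t * n) +
          ENNReal.ofReal (s / n) * ‖logRatio v z‖ₑ ^ 2 + ENNReal.ofReal (s / n)⁻¹ *
            {x : ℝ | t * n < |x|}.indicator 1 (logRatio v z)) :=
          lintegral_mono fun z => enorm_le_truncation _ (by positivity) (by positivity)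
      _ = ENNReal.ofReal (t * n) * ENNReal.ofReal V + ENNReal.ofReal (s / n) *
            (∫⁻ z in Metric.ball (0 : ℂ) M, ‖logRatio v z‖ₑ ^ 2) +
            ENNReal.ofReal (n / s) * I n v := by
          rw [lintegral_add_left (by fun_prop), lintegral_add_left (by fun_prop), setLIntegral_const,
            lintegral_const_mul _ (by fun_prop), lintegral_const_mul _ hindm, hVe, inv_div]
      _ ≤ ENNReal.ofReal (t * n) * ENNReal.ofReal V + ENNReal.ofReal (s / n) *
            (4 * n ^ 2 * ENNReal.ofReal C) + ENNReal.ofReal (n / s) * I n v := by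
          rw [← hCe]; gcongr
      _ = ENNReal.ofReal ((t * V + 4 * s * C) * n) + ENNReal.ofReal (n / s) * I n v := by
          have h4 : (4 * n ^ 2 : ℝ≥0∞) = ENNReal.ofReal (4 * n ^ 2) := by
            rw [ENNReal.ofReal_mul (by norm_num), ENNReal.ofReal_pow (by positivity)]; simp
          rw [h4, ← ENNReal.ofReal_mul (by positivity), ← ENNReal.ofReal_mul (by positivity),
            ← ENNReal.ofReal_mul (by positivity), ← ENNReal.ofReal_add (by positivity)
            (by positivity)]
          congr 2
          field_simp
      _ ≤ _ := by gcongr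
  by_contra! hlt
  have hlt' : ENNReal.ofReal (n / s) * I n v < ENNReal.ofReal (ε / 2 * n) := by
    have hpos : 0 < ENNReal.ofReal (n / s) := ENNReal.ofReal_pos.2 (by positivity)
    calc _ < ENNReal.ofReal (n / s) * ENNReal.ofReal (ε / 2 * s) :=
          ENNReal.mul_lt_mul_right hpos.ne' ENNReal.ofReal_ne_top hlt
      _ = _ := by
          rw [← ENNReal.ofReal_mul (by positivity)]
          congr 1
          field_simp
  have := hbound.trans_lt (ENNReal.add_lt_add_left ENNReal.ofReal_ne_top hlt')
  rw [← ENNReal.ofReal_add (by positivity) (by positivity)] at this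
  refine this.ne ?_
  congr 1
  ring

/-- The roots of `p - p(0)` are asymptotically distributed according to `μ`. -/
theorem tendsto_measure_sum_roots (h : IsAnnular μ K ρ R) (g : ℂ →ᵇ ℝ) {ε : ℝ} (hε : 0 < ε) :
    Tendsto (fun n : ℕ => (Measure.pi fun _ : Fin n => μ)
      {v | ε * n ≤ |((subValueAtZero (polyOfRoots v)).roots.map g).sum - n * ∫ w, g w ∂μ|})
      atTop (𝓝 0) := by
  have := h.isProbabilityMeasure
  obtain ⟨C, M, hC, hCM⟩ := exists_enorm_sum_sub_le g (2 * R) (by positivity : 0 < ε / 4)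
  have hg : MemLp g 2 μ := MemLp.of_bound g.continuous.aestronglyMeasurable ‖g‖
    (ae_of_all _ g.norm_coe_le_norm)
  have hlim := (tendsto_measure_pi_abs_sum_sub hg (by positivity : 0 < ε / 4)).add
    (h.tendsto_measure_le_lintegral_logRatio M
      (by have := C.toReal_nonneg; positivity : 0 < ε / 4 / (C.toReal + 1)))
  rw [add_zero] at hlim
  refine tendsto_of_tendsto_of_tendsto_of_le_of_le' tendsto_const_nhds hlim
    (Eventually.of_forall fun _ => bot_le) ?_
  filter_upwards [eventually_ge_atTop 1] with n hn
  have hn0 : (0 : ℝ) < n := by exact_mod_cast hn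
  refine (measure_mono_ae ?_).trans (measure_union_le _ _)
  filter_upwards [h.ae_norm_roots_le n] with v hv hle
  replace hle : ε * n ≤
    |((subValueAtZero (polyOfRoots v)).roots.map g).sum - n * ∫ w, g w ∂μ| := hle
  by_contra hcon
  replace hcon := not_or.1 (fun hh => hcon ((Set.mem_union _ _ _).2 hh))
  rw [Set.mem_ofPred_eq, Set.mem_ofPred_eq, not_le, not_le] at hcon
  obtain ⟨h1, h2⟩ := hcon
  obtain ⟨a, ha⟩ := exists_roots_eq_map v
  have heq : ∫⁻ z in Metric.ball (0 : ℂ) M, ‖logRatio v z‖ₑ =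
      ∫⁻ z in Metric.ball (0 : ℂ) M, ‖potentialDiff a v z‖ₑ :=
    lintegral_congr_ae (ae_restrict_of_ae ((ae_logRatio_eq_potentialDiff ha).mono
      fun z hz => by simp only [hz]))
  have h3 := hCM n a v (fun i => hv.2 _ (by simp [ha])) hv.1
  rw [heq] at h2
  have hCr := C.toReal_nonneg
  have h4 : C * ∫⁻ z in Metric.ball 0 M, ‖potentialDiff a v z‖ₑ ≤ ENNReal.ofReal (ε / 4 * n) := by
    calc _ ≤ ENNReal.ofReal C.toReal * ENNReal.ofReal (ε / 4 / (C.toReal + 1) * n) := by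
          rw [ENNReal.ofReal_toReal hC]; gcongr
      _ ≤ _ := by
          rw [← ENNReal.ofReal_mul hCr]
          refine ENNReal.ofReal_le_ofReal ?_
          rw [← mul_assoc, mul_div_assoc', div_mul_eq_mul_div, div_le_iff₀ (by positivity)]
          have : 0 < ε * n := by positivity
          nlinarith
  have h5 : ‖∑ i, (g (a i) - g (v i))‖ₑ ≤ ENNReal.ofReal (ε / 2 * n) := by
    refine (h3.trans (add_le_add le_rfl h4)).trans (le_of_eq ?_)
    rw [← ENNReal.ofReal_add (by positivity) (by positivity)]
    congr 1
    ring
  rw [Real.enorm_eq_ofReal_abs, ENNReal.ofReal_le_ofReal_iff (by positivity),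
    Finset.sum_sub_distrib] at h5
  have h6 : ((subValueAtZero (polyOfRoots v)).roots.map g).sum = ∑ i, g (a i) := by
    rw [ha, Multiset.map_map]; rfl
  rw [h6] at hle
  have h7 := abs_add_le (∑ i, g (a i) - ∑ i, g (v i)) (∑ i, g (v i) - n * ∫ w, g w ∂μ)
  rw [sub_add_sub_cancel] at h7
  have : 0 < ε * n := by positivity
  linarith

end IsAnnular

/-! ### The Blaschke factorization -/

lemma rootsInDisk_add_rootsOutsideDisk (f : ℂ[X]) : rootsInDisk f + rootsOutsideDisk f = f.roots := by
  classical
  unfold rootsInDisk rootsOutsideDisk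
  convert Multiset.filter_add_not (fun α : ℂ => ‖α‖ ≤ 1) f.roots

lemma mem_rootsInDisk {f : ℂ[X]} {α : ℂ} : α ∈ rootsInDisk f ↔ α ∈ f.roots ∧ ‖α‖ ≤ 1 := by
  simp only [rootsInDisk, Multiset.mem_filter]

lemma mem_rootsOutsideDisk {f : ℂ[X]} {α : ℂ} :
    α ∈ rootsOutsideDisk f ↔ α ∈ f.roots ∧ ¬ ‖α‖ ≤ 1 := by
  simp only [rootsOutsideDisk, Multiset.mem_filter]

/-- For `|α| = 1` the denominator vanishes only at `z = α`, where both sides are `0` despite the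
division by zero; so only poles with `|α| < 1` are excluded. -/
lemma blaschke_factor_mul {α z : ℂ} (hα : ‖α‖ ≤ 1) (hz : ‖α‖ < 1 → 1 - conj α * z ≠ 0) :
    (z - α) / (1 - conj α * z) * (1 - conj α * z) = z - α := by
  by_cases h : 1 - conj α * z = 0
  · have h1 : ‖α‖ = 1 := le_antisymm hα (not_lt.1 fun hlt => hz hlt h)
    have h2 : conj α * α = 1 := by
      rw [← Complex.normSq_eq_conj_mul_self, Complex.normSq_eq_norm_sq, h1]; simp
    have h3 : z = α := by
      have h4 : conj α * z = conj α * α := by rw [h2, ← sub_eq_zero.1 h]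
      refine mul_left_cancel₀ (fun h0 => ?_) h4
      rw [h0, zero_mul] at h2
      exact zero_ne_one h2
    rw [h, h3, sub_self, mul_zero]
  · exact div_mul_cancel₀ _ h

lemma eval_outerFactor (f : ℂ[X]) (z : ℂ) :
    (outerFactor f).eval z = f.leadingCoeff * ((rootsInDisk f).map fun α => 1 - conj α * z).prod *
      ((rootsOutsideDisk f).map fun α => z - α).prod := by
  simp [outerFactor, Polynomial.eval_mul, Polynomial.eval_multiset_prod, Multiset.map_map]

/-- The Blaschke factorization of a polynomial. -/
lemma blaschkeProduct_mul_eval_outerFactor (f : ℂ[X]) {z : ℂ}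
    (hz : ∀ α ∈ f.roots, ‖α‖ < 1 → 1 - conj α * z ≠ 0) :
    blaschkeProduct f z * (outerFactor f).eval z = f.eval z := by
  have h1 : blaschkeProduct f z * ((rootsInDisk f).map fun α => 1 - conj α * z).prod =
      ((rootsInDisk f).map fun α => z - α).prod := by
    rw [blaschkeProduct, ← Multiset.prod_map_mul]
    refine congrArg _ (Multiset.map_congr rfl fun α hα => ?_)
    rw [mem_rootsInDisk] at hα
    exact blaschke_factor_mul hα.2 (hz α hα.1)
  have h2 := congrArg (Polynomial.eval z) (IsAlgClosed.splits f).eq_prod_roots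
  rw [← rootsInDisk_add_rootsOutsideDisk f] at h2
  rw [h2, eval_outerFactor]
  simp only [Polynomial.eval_mul, Polynomial.eval_C, Polynomial.eval_multiset_prod,
    Multiset.map_map, Multiset.map_add, Multiset.prod_add, Function.comp_def, Polynomial.eval_sub,
    Polynomial.eval_X]
  rw [← h1]
  ring

lemma eval_outerFactor_ne_zero {f : ℂ[X]} (hf : f ≠ 0) {z : ℂ} (hz : ‖z‖ < 1) :
    (outerFactor f).eval z ≠ 0 := by
  rw [eval_outerFactor]
  refine mul_ne_zero (mul_ne_zero (Polynomial.leadingCoeff_ne_zero.2 hf) ?_) ?_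
  · refine Multiset.prod_ne_zero fun h => ?_
    obtain ⟨α, hα, h0⟩ := Multiset.mem_map.1 h
    have h1 : ‖conj α * z‖ = 1 := by rw [← sub_eq_zero.1 h0, norm_one]
    rw [norm_mul, Complex.norm_conj] at h1
    nlinarith [(mem_rootsInDisk.1 hα).2, norm_nonneg α, norm_nonneg z]
  · refine Multiset.prod_ne_zero fun h => ?_
    obtain ⟨α, hα, h0⟩ := Multiset.mem_map.1 h
    rw [sub_eq_zero.1 h0] at hz
    exact (mem_rootsOutsideDisk.1 hα).2 hz.le

/-- `E` consists of the reflected roots `1 / conj α`. It can be smaller than the set of disk roots,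
because `α = 0` contributes the constant factor `1`. -/
lemma exists_roots_outerFactor {f : ℂ[X]} (hf : f ≠ 0) :
    ∃ E : Multiset ℂ, (outerFactor f).roots = rootsOutsideDisk f + E ∧
      E.card ≤ (rootsInDisk f).card := by
  set q : ℂ[X] :=
    ((rootsInDisk f).map fun α => 1 - Polynomial.C (conj α) * Polynomial.X).prod with hq
  have hG : outerFactor f ≠ 0 := fun h => by
    have := eval_outerFactor_ne_zero hf (z := 0) (by simp)
    rw [h] at this
    simp at this
  refine ⟨q.roots, ?_, ?_⟩
  · have hG' := hG
    rw [outerFactor] at hG'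
    rw [outerFactor, Polynomial.roots_mul hG',
      Polynomial.roots_C_mul _ (Polynomial.leadingCoeff_ne_zero.2 hf),
      Polynomial.roots_multiset_prod_X_sub_C, add_comm]
  · refine (Polynomial.card_roots' q).trans ((Polynomial.natDegree_multiset_prod_le _).trans ?_)
    rw [Multiset.map_map]
    refine (Multiset.sum_le_card_nsmul _ 1 fun x hx => ?_).trans (by simp)
    obtain ⟨α, -, rfl⟩ := Multiset.mem_map.1 hx
    simp only [Function.comp_apply]
    compute_degree

/-! ### Empirical measures of `f` and of its outer factor -/

lemma integrable_and_integral_sum_dirac (g : ℂ →ᵇ ℝ) (s : Multiset ℂ) :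
    Integrable g (s.map fun w => Measure.dirac w).sum ∧
      ∫ w, g w ∂(s.map fun w => Measure.dirac w).sum = (s.map g).sum := by
  induction s using Multiset.induction_on with
  | empty => simp
  | cons a s ih =>
    have ha : Integrable g (Measure.dirac a) := g.integrable _
    simp only [Multiset.map_cons, Multiset.sum_cons]
    refine ⟨ha.add_measure ih.1, ?_⟩
    rw [integral_add_measure ha ih.1, ih.2, integral_dirac]

lemma integral_empiricalMeasure (g : ℂ →ᵇ ℝ) (s : Multiset ℂ) :
    ∫ w, g w ∂(empiricalMeasure s) = (s.card : ℝ)⁻¹ * (s.map g).sum := by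
  rw [empiricalMeasure, integral_smul_measure, (integrable_and_integral_sum_dirac g s).2]
  simp

lemma abs_sum_map_le (g : ℂ →ᵇ ℝ) (s : Multiset ℂ) : |(s.map g).sum| ≤ s.card * ‖g‖ := by
  induction s using Multiset.induction_on with
  | empty => simp
  | cons a s ih =>
    simp only [Multiset.map_cons, Multiset.sum_cons, Multiset.card_cons, Nat.cast_add, Nat.cast_one]
    have := g.norm_coe_le_norm a
    rw [Real.norm_eq_abs] at this
    have := abs_add_le (g a) (s.map g).sum
    linarith

/-- If `f` has few roots in the disk, the roots of its outer factor are distributed as those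
of `f`. -/
lemma abs_integral_empiricalMeasure_outerFactor_sub_lt {f : ℂ[X]} (hf : f ≠ 0) (g : ℂ →ᵇ ℝ)
    {c ε : ℝ} (hc : |c| ≤ ‖g‖) (hn : 0 < f.roots.card)
    (hN : 2 * ((rootsInDisk f).card : ℝ) ≤ f.roots.card)
    (hNε : 12 * ((rootsInDisk f).card : ℝ) * ‖g‖ ≤ ε * f.roots.card)
    (hD : 4 * |(f.roots.map g).sum - f.roots.card * c| < ε * f.roots.card) :
    |∫ w, g w ∂(empiricalMeasure (outerFactor f).roots) - c| < ε := by
  obtain ⟨E, hE, hEN⟩ := exists_roots_outerFactor hf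
  have hEN' : (E.card : ℝ) ≤ (rootsInDisk f).card := by exact_mod_cast hEN
  have hcard : (f.roots.card : ℝ) = (rootsInDisk f).card + (rootsOutsideDisk f).card := by
    rw [← rootsInDisk_add_rootsOutsideDisk f]; push_cast [Multiset.card_add]; ring
  have hsum : (f.roots.map g).sum =
      ((rootsInDisk f).map g).sum + ((rootsOutsideDisk f).map g).sum := by
    rw [← rootsInDisk_add_rootsOutsideDisk f, Multiset.map_add, Multiset.sum_add]
  have hn' : (0 : ℝ) < f.roots.card := by exact_mod_cast hn
  have h1 := abs_sum_map_le g (rootsInDisk f)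
  have h2 := abs_sum_map_le g E
  have hg := norm_nonneg g
  have hE0 : (0 : ℝ) ≤ E.card := by positivity
  have hN0 : (0 : ℝ) ≤ (rootsInDisk f).card := by positivity
  rw [integral_empiricalMeasure, hE, Multiset.card_add, Multiset.map_add, Multiset.sum_add]
  push_cast
  set N : ℝ := ((rootsInDisk f).card : ℝ)
  set m : ℝ := ((rootsOutsideDisk f).card : ℝ)
  set e : ℝ := (E.card : ℝ)
  set n : ℝ := (f.roots.card : ℝ)
  have hm : 0 < m + e := by linarith
  have h3 : (m + e)⁻¹ * (((rootsOutsideDisk f).map g).sum + (E.map g).sum) - c =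
      (((rootsOutsideDisk f).map g).sum + (E.map g).sum - (m + e) * c) / (m + e) := by
    field_simp
  rw [h3, abs_div, abs_of_pos hm, div_lt_iff₀ hm]
  -- The last three terms contribute at most `N‖g‖ + e‖g‖ + (N - e)‖g‖ = 2N‖g‖ ≤ ε n / 6` and the
  -- first less than `ε n / 4`, while `m + e ≥ n / 2` by `hN`.
  have h4 : ((rootsOutsideDisk f).map g).sum + (E.map g).sum - (m + e) * c =
      ((f.roots.map g).sum - n * c) - ((rootsInDisk f).map g).sum + (E.map g).sum + (N - e) * c := by
    rw [hsum, hcard]; ring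
  have h5 : |(N - e) * c| ≤ (N - e) * ‖g‖ := by
    rw [abs_mul, abs_of_nonneg (by linarith)]
    exact mul_le_mul_of_nonneg_left hc (by linarith)
  have hεpos : 0 < ε := by
    by_contra! hneg
    nlinarith [abs_nonneg ((f.roots.map g).sum - n * c)]
  rw [h4]
  refine (abs_add_le _ _).trans_lt ?_
  refine (add_le_add_left ((abs_add_le _ _).trans (add_le_add_left (abs_sub _ _) _)) _).trans_lt ?_
  nlinarith

lemma card_rootsInDisk_le_sum {g : ℂ → ℝ} (hg0 : ∀ w, 0 ≤ g w) (hg1 : ∀ w, ‖w‖ ≤ 1 → g w = 1)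
    (f : ℂ[X]) : ((rootsInDisk f).card : ℝ) ≤ (f.roots.map g).sum := by
  rw [← rootsInDisk_add_rootsOutsideDisk f, Multiset.map_add, Multiset.sum_add,
    Multiset.map_congr rfl fun α hα => hg1 α (mem_rootsInDisk.1 hα).2]
  have : 0 ≤ ((rootsOutsideDisk f).map g).sum := Multiset.sum_nonneg fun x hx => by
    obtain ⟨α, -, rfl⟩ := Multiset.mem_map.1 hx
    exact hg0 α
  simpa using this

/-! ### Asymptotics for disk roots and outer factors under the product measure -/

namespace IsAnnular

variable {μ : Measure ℂ} {K : ℝ≥0∞} {ρ R : ℝ}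

/-- With high probability `p - p(0)` has only `o(n)` roots in the closed unit disk. -/
theorem tendsto_measure_card_rootsInDisk (h : IsAnnular μ K ρ R) {ε : ℝ} (hε : 0 < ε) :
    Tendsto (fun n : ℕ => (Measure.pi fun _ : Fin n => μ)
      {v | ε * n ≤ ((rootsInDisk (subValueAtZero (polyOfRoots v))).card : ℝ)}) atTop (𝓝 0) := by
  have hρ := sub_pos.2 h.one_lt
  -- A cutoff equal to `1` on the closed unit disk and to `0` for `‖w‖ ≥ ρ`: its sum over the roots
  -- dominates the disk count, while its `μ`-integral is `0`.
  set g : ℂ →ᵇ ℝ := BoundedContinuousFunction.ofNormedAddCommGroup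
    (fun w => max 0 (min 1 ((ρ - ‖w‖) / (ρ - 1)))) (by fun_prop) 1 (fun w => by
      rw [Real.norm_of_nonneg (le_max_left _ _)]
      exact max_le zero_le_one (min_le_left _ _)) with hg
  have hgw : ∀ w, g w = max 0 (min 1 ((ρ - ‖w‖) / (ρ - 1))) := fun w => rfl
  have hint : ∫ w, g w ∂μ = 0 := by
    refine integral_eq_zero_of_ae ?_
    filter_upwards [h.ae_mem] with w hw
    rw [hgw, Pi.zero_apply, max_eq_left]
    exact (min_le_right _ _).trans (div_nonpos_of_nonpos_of_nonneg (by linarith [hw.1]) hρ.le)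
  refine tendsto_of_tendsto_of_tendsto_of_le_of_le tendsto_const_nhds
    (h.tendsto_measure_sum_roots g hε) (fun _ => bot_le) fun n => measure_mono fun v hv => ?_
  rw [Set.mem_ofPred_eq] at hv ⊢
  rw [hint, mul_zero, sub_zero]
  refine hv.trans ((card_rootsInDisk_le_sum (g := g) (fun w => le_max_left _ _) (fun w hw => ?_)
    _).trans (le_abs_self _))
  rw [hgw, min_eq_left, max_eq_right zero_le_one]
  rw [le_div_iff₀ hρ]
  linarith

/-- The roots of the outer factor of `p - p(0)` are asymptotically distributed according
to `μ`. -/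
theorem tendsto_measure_integral_empiricalMeasure (h : IsAnnular μ K ρ R) (g : ℂ →ᵇ ℝ) {ε : ℝ}
    (hε : 0 < ε) :
    Tendsto (fun n : ℕ => (Measure.pi fun _ : Fin n => μ)
      {v | ε ≤ |∫ w, g w ∂(empiricalMeasure (outerFactor (subValueAtZero (polyOfRoots v))).roots) -
        ∫ w, g w ∂μ|}) atTop (𝓝 0) := by
  have := h.isProbabilityMeasure
  have hg := norm_nonneg g
  -- The two entries supply the hypotheses `hN` and `hNε` of the deterministic comparison; `+ 1`
  -- covers `g = 0`.
  have hδ : 0 < min (1 / 2) (ε / (12 * (‖g‖ + 1))) := by positivity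
  have hlim := (h.tendsto_measure_card_rootsInDisk hδ).add
    (h.tendsto_measure_sum_roots g (by positivity : 0 < ε / 4))
  rw [add_zero] at hlim
  refine tendsto_of_tendsto_of_tendsto_of_le_of_le' tendsto_const_nhds hlim
    (Eventually.of_forall fun _ => bot_le) ?_
  filter_upwards [eventually_ge_atTop 1] with n hn
  have hn0 : (0 : ℝ) < n := by exact_mod_cast hn
  refine (measure_mono fun v hv => ?_).trans (measure_union_le _ _)
  by_contra hcon
  replace hcon := not_or.1 (fun hh => hcon ((Set.mem_union _ _ _).2 hh))
  rw [Set.mem_ofPred_eq, Set.mem_ofPred_eq, not_le, not_le] at hcon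
  obtain ⟨h1, h2⟩ := hcon
  refine not_lt.2 hv (abs_integral_empiricalMeasure_outerFactor_sub_lt
    (monic_subValueAtZero hn v).ne_zero g ?_ ?_ ?_ ?_ ?_)
  · have := norm_integral_le_of_norm_le_const (μ := μ) (ae_of_all _ g.norm_coe_le_norm)
    simpa using this
  · rwa [card_roots_subValueAtZero]
  · rw [card_roots_subValueAtZero]
    have := mul_le_mul_of_nonneg_right (min_le_left (1 / 2) (ε / (12 * (‖g‖ + 1)))) hn0.le
    linarith
  · rw [card_roots_subValueAtZero]
    have h3 := h1.le.trans
      (mul_le_mul_of_nonneg_right (min_le_right (1 / 2) (ε / (12 * (‖g‖ + 1)))) hn0.le)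
    rw [div_mul_eq_mul_div, le_div_iff₀ (by positivity)] at h3
    have : (0 : ℝ) ≤ (rootsInDisk (subValueAtZero (polyOfRoots v))).card := by positivity
    nlinarith
  · rw [card_roots_subValueAtZero]
    linarith

end IsAnnular

/-! ### Radial measures are annular, and transfer to arbitrary probability spaces -/

/-- `ρ` and `R` are the extreme points of the compact support of `φ`, so `ρ > 1` because the minimum
is attained; `K` comes from a bound on `|φ|`. -/
lemma exists_isAnnular_radialMeasure {φ : ℝ → ℝ} (hφ : Continuous φ)
    (hφ_compact : HasCompactSupport φ) (hφ_supp : tsupport φ ⊆ Set.Ioi 1)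
    (hφ_prob : IsProbabilityMeasure (radialMeasure φ)) :
    ∃ K ρ R, IsAnnular (radialMeasure φ) K ρ R := by
  have hdm : Measurable fun z : ℂ => ENNReal.ofReal (φ ‖z‖) := by fun_prop
  have hae : ∀ᵐ v ∂radialMeasure φ, ‖v‖ ∈ tsupport φ := by
    rw [radialMeasure, ae_withDensity_iff hdm]
    refine ae_of_all _ fun v hv => subset_tsupport φ ?_
    intro h0
    simp [h0] at hv
  obtain ⟨v, hv⟩ := hae.exists
  obtain ⟨ρ, hρ, hρle⟩ := IsCompact.exists_isLeast hφ_compact ⟨_, hv⟩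
  obtain ⟨R, -, hRle⟩ := IsCompact.exists_isGreatest hφ_compact ⟨_, hv⟩
  obtain ⟨B, hB⟩ := hφ_compact.exists_bound_of_continuous hφ
  refine ⟨ENNReal.ofReal B, ρ, R, hφ_prob, hφ_supp hρ, ENNReal.ofReal_ne_top, ?_, ?_, fun c => ?_⟩
  · rw [radialMeasure, ← withDensity_const]
    exact withDensity_mono (ae_of_all _ fun v =>
      ENNReal.ofReal_le_ofReal ((le_abs_self _).trans (hB _)))
  · filter_upwards [hae] with v hv
    exact ⟨hρle hv, hRle hv⟩
  · have hmp : MeasurePreserving (fun v : ℂ => (c : ℂ) * v) (volume : Measure ℂ) volume :=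
      (rotation c).measurePreserving
    refine ⟨hmp.measurable, Measure.ext fun s hs => ?_⟩
    rw [Measure.map_apply hmp.measurable hs, radialMeasure,
      withDensity_apply _ (hmp.measurable hs), withDensity_apply _ hs,
      ← hmp.setLIntegral_comp_preimage hs hdm]
    simp_rw [norm_mul, Circle.norm_coe, one_mul]

/-- The inequality, unlike equality, needs no measurability of `q`, so events about roots can be
transferred without showing that they are measurable. -/
lemma measure_setOf_le_pi {Ω : Type*} [MeasurableSpace Ω] {P : Measure Ω} [IsProbabilityMeasure P]
    {μ : Measure ℂ} {n : ℕ} {Z : Fin n → Ω → ℂ} (hlaw : ∀ k, HasLaw (Z k) μ P)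
    (hindep : iIndepFun Z P) (q : (Fin n → ℂ) → Prop) :
    P {ω | q fun k => Z k ω} ≤ Measure.pi (fun _ : Fin n => μ) {v | q v} := by
  have hm : ∀ k, AEMeasurable (Z k) P := fun k => (hlaw k).aemeasurable
  have h := hindep.map_fun_eq_pi_map hm
  simp_rw [fun k => (hlaw k).map_eq] at h
  rw [← h]
  exact Measure.le_map_apply (aemeasurable_pi_lambda _ hm) {v | q v}

end RandomBlaschke

open RandomBlaschke in
theorem mainTheorem4 (φ : ℝ → ℝ) (hφ_smooth : ContDiff ℝ (⊤ : ℕ∞) φ) (hφ_nonneg : ∀ r, 0 ≤ φ r)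
    (hφ_compact : HasCompactSupport φ) (hφ_supp : tsupport φ ⊆ Set.Ioi 1)
    (hφ_prob : IsProbabilityMeasure (radialMeasure φ))
    {Ω : ℕ → Type*} [∀ n, MeasurableSpace (Ω n)]
    (P : ∀ n, Measure (Ω n)) [∀ n, IsProbabilityMeasure (P n)]
    (Z : ∀ n, Fin n → Ω n → ℂ)
    (hZ_law : ∀ n k, HasLaw (Z n k) (radialMeasure φ) (P n))
    (hZ_indep : ∀ n, iIndepFun (Z n) (P n))
    (p f G : ∀ n, Ω n → ℂ[X])
    (hp : ∀ n ω, p n ω = polyOfRoots fun k => Z n k ω)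
    (hf : ∀ n ω, f n ω = subValueAtZero (p n ω))
    (hG : ∀ n ω, G n ω = outerFactor (f n ω)) :
    -- `p = p(0) + B * G` off the poles of `B`, and `G` has no zeros inside the unit disk
    (∀ n, 1 ≤ n → ∀ ω,
      (∀ z : ℂ, (∀ α ∈ (f n ω).roots, ‖α‖ < 1 → 1 - conj α * z ≠ 0) →
        (p n ω).eval z = (p n ω).eval 0 + blaschkeProduct (f n ω) z * (G n ω).eval z) ∧
      (∀ z : ℂ, ‖z‖ < 1 → (G n ω).eval z ≠ 0)) ∧
    -- the roots of `G` are asymptotically distributed according to `μ`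
    TendstoWeaklyInProbability P (fun n ω => empiricalMeasure (G n ω).roots) (radialMeasure φ) ∧
    -- with high probability `p - p(0)` has only `o(n)` roots in the unit disk
    (∀ ε : ℝ, 0 < ε →
      Tendsto (fun n : ℕ => P n {ω | ε * n ≤ ((rootsInDisk (f n ω)).card : ℝ)}) atTop (𝓝 0)) := by
  obtain ⟨K, ρ, R, h⟩ := exists_isAnnular_radialMeasure hφ_smooth.continuous hφ_compact hφ_supp
    hφ_prob
  have hfp : ∀ n ω, f n ω = subValueAtZero (polyOfRoots fun k => Z n k ω) := fun n ω => by
    rw [hf, hp]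
  refine ⟨fun n hn ω => ⟨fun z hz => ?_, fun z hz => ?_⟩, fun g ε hε => ?_, fun ε hε => ?_⟩
  · rw [hG, blaschkeProduct_mul_eval_outerFactor _ hz, hf, eval_subValueAtZero]
    ring
  · rw [hG, hfp]
    exact eval_outerFactor_ne_zero (monic_subValueAtZero hn _).ne_zero hz
  · simp_rw [hG, hfp]
    exact tendsto_of_tendsto_of_tendsto_of_le_of_le tendsto_const_nhds
      (h.tendsto_measure_integral_empiricalMeasure g hε) (fun _ => bot_le) fun n =>
        measure_setOf_le_pi (hZ_law n) (hZ_indep n) fun v => ε ≤ |∫ w, g w ∂(empiricalMeasure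
          (outerFactor (subValueAtZero (polyOfRoots v))).roots) - ∫ w, g w ∂(radialMeasure φ)|
  · simp_rw [hfp]
    exact tendsto_of_tendsto_of_tendsto_of_le_of_le tendsto_const_nhds
      (h.tendsto_measure_card_rootsInDisk hε) (fun _ => bot_le) fun n =>
        measure_setOf_le_pi (hZ_law n) (hZ_indep n) fun v =>
          ε * n ≤ ((rootsInDisk (subValueAtZero (polyOfRoots v))).card : ℝ)
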